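/- Let $\mathbb{N}=\{0,1,2,\dots\}$ and let $\mathbb{B}_1,\mathbb{B}_2$ be Banach spaces over the same field ($\mathbb{R}$ or $\mathbb{C}$). For a Banach space $\mathbb{B}$, $\ell^r_{\mathbb{B}}(\mathbb{N})$ denotes the space of $\mathbb{B}$-valued $r$-summable sequences. For $w:\mathbb{N}\to(0,\infty)$ and $1\le p<\infty$, $\ell^p_{\mathbb{B}}(\mathbb{N},w)$ denotes the space of sequences $f:\mathbb{N}\to\mathbb{B}$ with $\|f\|_{\ell^p_{\mathbb{B}}(\mathbb{N},w)}=\big(\sum_n\|f(n)\|^p w(n)\big)^{1/p}<\infty$, and $\ell^{1,\infty}_{\mathbb{B}}(\mathbb{N},w)$ the space of sequences with $\|f\|_{\ell^{1,\infty}_{\mathbb{B}}(\mathbb{N},w)}=\sup_{t>0}t\sum_{n:\,\|f(n)\|>t}w(n)<\infty$. We write $w\in A_p(\mathbb{N})$, $1<p<\infty$, if $$\sup_{0\le n\le m}\frac{1}{(m-n+1)^p}\Big(\sum_{k=n}^m w(k)\Big)\Big(\sum_{k=n}^m w(k)^{-1/(p-1)}\Big)^{p-1}<\infty ,$$ and $w\in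 A_1(\mathbb{N})$ if $$\sup_{0\le n\le m}\frac{1}{m-n+1}\Big(\sum_{k=n}^m w(k)\Big)\max_{n\le k\le m}\frac1{w(k)}<\infty .$$ **Theorem.** Let $1<r<\infty$ and let $T$ be a bounded linear operator from $\ell^r_{\mathbb{B}_1}(\mathbb{N})$ into $\ell^r_{\mathbb{B}_2}(\mathbb{N})$. Suppose that there are $C>0$ and a function $K:\{(n,m)\in\mathbb{N}^2:n\ne m\}\to\mathcal{L}(\mathbb{B}_1,\mathbb{B}_2)$ such that * (a) $\|K(n,m)\|\le \dfrac{C}{|n-m|}$ for all $n\neq m$; * (b) $\|K(n,m)-K(\ell,m)\|\le C\dfrac{|n-\ell|}{|n-m|^2}$ and $\|K(m,n)-K(m,\ell)\|\le C\dfrac{|n-\ell|}{|n-m|^2}$ for all $n,m,\ell\in\mathbb{N}$ with $|n-m|>2|n-\ell|$ and $\frac m2<n,\ell<\frac{3m}2$; * (c) for every finitely supported $f:\mathbb{N}\to\mathbb{B}_1$ and every $n$ with $f(n)=0$, $\;T(f)(n)=\sum_{m\ne n}K(n,m)f(m)$. Then: (i) for every $1<p<\infty$ and $w\in A_p(\mathbb{N})$,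 the restriction of $T$ to $\ell^r_{\mathbb{B}_1}(\mathbb{N})\cap\ell^p_{\mathbb{B}_1}(\mathbb{N},w)$ extends to a bounded linear operator from $\ell^p_{\mathbb{B}_1}(\mathbb{N},w)$ into $\ell^p_{\mathbb{B}_2}(\mathbb{N},w)$; (ii) for every $w\in A_1(\mathbb{N})$, the restriction of $T$ to $\ell^r_{\mathbb{B}_1}(\mathbb{N})\cap\ell^1_{\mathbb{B}_1}(\mathbb{N},w)$ extends to a bounded linear operator from $\ell^1_{\mathbb{B}_1}(\mathbb{N},w)$ into $\ell^{1,\infty}_{\mathbb{B}_2}(\mathbb{N},w)$. -/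

import Mathlib

open MeasureTheory
open scoped ENNReal NNReal

/-- The measure on `ℕ` giving mass `w n` to the point `n`. -/
noncomputable def weightMeasure (w : ℕ → ℝ) : Measure ℕ :=
  Measure.sum fun n => ENNReal.ofReal (w n) • Measure.dirac n

/-- The Muckenhoupt class `A_p(ℕ)`, for `1 < p < ∞`. -/
def IsMuckenhouptAp (p : ℝ) (w : ℕ → ℝ) : Prop :=
  (∀ n, 0 < w n) ∧
    ∃ A : ℝ, ∀ n m : ℕ, n ≤ m →
      1 / ((m : ℝ) - n + 1) ^ p * (∑ k ∈ Finset.Icc n m, w k) *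
        (∑ k ∈ Finset.Icc n m, w k ^ (-1 / (p - 1))) ^ (p - 1) ≤ A

/-- The Muckenhoupt class `A_1(ℕ)`. -/
def IsMuckenhouptA1 (w : ℕ → ℝ) : Prop :=
  (∀ n, 0 < w n) ∧
    ∃ A : ℝ, ∀ (n m : ℕ) (h : n ≤ m),
      1 / ((m : ℝ) - n + 1) * (∑ k ∈ Finset.Icc n m, w k) *
        (Finset.Icc n m).sup' (Finset.nonempty_Icc.2 h) (fun k => 1 / w k) ≤ A

/-- The weighted space `ℓ^p_E(ℕ, w)` of `E`-valued sequences; its norm is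
`eLpNorm f p (weightMeasure w)`, that is, `(∑ ‖f n‖ ^ p * w n) ^ (1 / p)`. For a strictly positive
weight every null set is empty, so there is no need to pass to classes. -/
def weightedLp (𝕜 E : Type*) [RCLike 𝕜] [NormedAddCommGroup E] [NormedSpace 𝕜 E]
    (p : ℝ≥0∞) (w : ℕ → ℝ) : Submodule 𝕜 (ℕ → E) where
  carrier := {f | MemLp f p (weightMeasure w)}
  zero_mem' := MemLp.zero
  add_mem' hf hg := hf.add hg
  smul_mem' c _ hf := hf.const_smul c

/-- The quasinorm of the weak space `ℓ^{1,∞}_E(ℕ, w)`: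
the supremum over `t > 0` of `t` times the `w`-mass of `{n | t < ‖f n‖}`. -/
noncomputable def weakL1Norm {E : Type*} [NormedAddCommGroup E] (w : ℕ → ℝ) (f : ℕ → E) : ℝ≥0∞ :=
  ⨆ t : ℝ≥0, (t : ℝ≥0∞) * weightMeasure w {n | t < ‖f n‖₊}

theorem weakL1Norm_add_le {E : Type*} [NormedAddCommGroup E] (w : ℕ → ℝ) (f g : ℕ → E) :
    weakL1Norm w (f + g) ≤ 2 * (weakL1Norm w f + weakL1Norm w g) := by
  refine iSup_le fun t => ?_
  have hsub : {n | t < ‖(f + g) n‖₊} ⊆ {n | t / 2 < ‖f n‖₊} ∪ {n | t / 2 < ‖g n‖₊} := by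
    intro n hn
    by_contra hc
    simp only [Set.mem_union, Set.mem_setOf_eq, not_or, not_lt] at hc
    have h1 : t < ‖f n‖₊ + ‖g n‖₊ := lt_of_lt_of_le hn (nnnorm_add_le _ _)
    have h2 := add_le_add hc.1 hc.2
    rw [add_halves] at h2
    exact absurd (lt_of_lt_of_le h1 h2) (lt_irrefl _)
  have ht : (t : ℝ≥0∞) = 2 * ((t / 2 : ℝ≥0) : ℝ≥0∞) := by
    have : t = 2 * (t / 2) := by field_simp
    exact_mod_cast congrArg ((↑) : ℝ≥0 → ℝ≥0∞) this
  calc (t : ℝ≥0∞) * weightMeasure w {n | t < ‖(f + g) n‖₊}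
      ≤ (t : ℝ≥0∞) * (weightMeasure w {n | t / 2 < ‖f n‖₊}
          + weightMeasure w {n | t / 2 < ‖g n‖₊}) := by
        gcongr
        exact (measure_mono hsub).trans (measure_union_le _ _)
    _ = 2 * (((t / 2 : ℝ≥0) : ℝ≥0∞) * weightMeasure w {n | t / 2 < ‖f n‖₊}
          + ((t / 2 : ℝ≥0) : ℝ≥0∞) * weightMeasure w {n | t / 2 < ‖g n‖₊}) := by
        rw [ht]; ring
    _ ≤ 2 * (weakL1Norm w f + weakL1Norm w g) := by
        gcongr
        · exact le_iSup (fun s : ℝ≥0 => (s : ℝ≥0∞) * weightMeasure w {n | s < ‖f n‖₊}) (t / 2)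
        · exact le_iSup (fun s : ℝ≥0 => (s : ℝ≥0∞) * weightMeasure w {n | s < ‖g n‖₊}) (t / 2)

theorem weakL1Norm_smul_le {𝕜 E : Type*} [RCLike 𝕜] [NormedAddCommGroup E] [NormedSpace 𝕜 E]
    (w : ℕ → ℝ) (c : 𝕜) (f : ℕ → E) :
    weakL1Norm w (c • f) ≤ (‖c‖₊ : ℝ≥0∞) * weakL1Norm w f := by
  refine iSup_le fun t => ?_
  rcases eq_or_ne c 0 with rfl | hc
  · simp
  have hc' : ‖c‖₊ ≠ 0 := nnnorm_ne_zero_iff.2 hc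
  have hset : {n | t < ‖(c • f) n‖₊} = {n | t / ‖c‖₊ < ‖f n‖₊} := by
    ext n
    simp only [Set.mem_setOf_eq, Pi.smul_apply, nnnorm_smul]
    rw [div_lt_iff₀ (pos_iff_ne_zero.2 hc'), mul_comm]
  have ht : (t : ℝ≥0∞) = ‖c‖₊ * ((t / ‖c‖₊ : ℝ≥0) : ℝ≥0∞) := by
    have : t = ‖c‖₊ * (t / ‖c‖₊) := by field_simp
    exact_mod_cast congrArg ((↑) : ℝ≥0 → ℝ≥0∞) this
  rw [hset]
  nth_rewrite 1 [ht]
  rw [mul_assoc]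
  gcongr
  exact le_iSup (fun s : ℝ≥0 => (s : ℝ≥0∞) * weightMeasure w {n | s < ‖f n‖₊}) (t / ‖c‖₊)

/-- The weighted weak space `ℓ^{1,∞}_E(ℕ, w)`. -/
def weightedWeakL1 (𝕜 E : Type*) [RCLike 𝕜] [NormedAddCommGroup E] [NormedSpace 𝕜 E]
    (w : ℕ → ℝ) : Submodule 𝕜 (ℕ → E) where
  carrier := {f | weakL1Norm w f < ∞}
  zero_mem' := by simp [weakL1Norm]
  add_mem' {f g} hf hg :=
    (weakL1Norm_add_le w f g).trans_lt
      (ENNReal.mul_lt_top (by simp) (ENNReal.add_lt_top.2 ⟨hf, hg⟩))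
  smul_mem' c f hf :=
    (weakL1Norm_smul_le w c f).trans_lt (ENNReal.mul_lt_top ENNReal.coe_lt_top hf)

/-- Local `L(E, F)`-standard kernels. The kernel is only meant off the diagonal: no condition
involves a value `K n n` (in the two regularity conditions `n ≠ m` and `l ≠ m` follow from
`|n - m| > 2 |n - l|`). -/
def IsLocalStandardKernel {𝕜 E F : Type*} [RCLike 𝕜] [NormedAddCommGroup E] [NormedSpace 𝕜 E]
    [NormedAddCommGroup F] [NormedSpace 𝕜 F] (K : ℕ → ℕ → E →L[𝕜] F) : Prop :=
  ∃ C : ℝ, 0 < C ∧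
    (∀ n m : ℕ, n ≠ m → ‖K n m‖ ≤ C / |(n : ℝ) - m|) ∧
    (∀ n m l : ℕ, |(n : ℝ) - m| > 2 * |(n : ℝ) - l| →
      (m : ℝ) / 2 < n → (n : ℝ) < 3 * m / 2 → (m : ℝ) / 2 < l → (l : ℝ) < 3 * m / 2 →
      ‖K n m - K l m‖ ≤ C * (|(n : ℝ) - l| / |(n : ℝ) - m| ^ 2)) ∧
    (∀ n m l : ℕ, |(n : ℝ) - m| > 2 * |(n : ℝ) - l| →
      (m : ℝ) / 2 < n → (n : ℝ) < 3 * m / 2 → (m : ℝ) / 2 < l → (l : ℝ) < 3 * m / 2 →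
      ‖K m n - K m l‖ ≤ C * (|(n : ℝ) - l| / |(n : ℝ) - m| ^ 2))

/-! Hypothesis (c), tested on sequences supported at one point, identifies the off-diagonal entries
of the matrix of `T` with `K`. Everything then reduces to bounds for the finite products `matApply`,
uniform over finite sets of rows and columns. The diagonal never enters the kernel estimates, which
only look outside triples of dyadic intervals.

The kernel is regular only in the local region. Far from the diagonal but outside that region, |n -
m| is at least a multiple of max(n, m), so the size bound alone gives a Hardy kernel. Hence the
oscillation of the kernel over a dyadic interval of length 2^k is at most a Poisson-type kernel 2^k
/ |n - m|^2 plus 1 / (max(n, m) + 1) (`norm_sub_le_oscMajorant`). The classical theory survives this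
extra term: its part m ≤ n is a Hardy average, controlled by a maximal function, and its part n ≤ m
is the dual Hardy operator, which is of strong type on ℓ^1 and on ℓ^1(w) for w in A_1.

A Calderón-Zygmund decomposition passes from an ℓ^q(w) bound to weak type (1,1) for w in A_1
(`weak_type_window`). It is used first with w = 1 and q = r. The unweighted weak bound drives a
stopping-time argument of sparse domination type (`exists_small_exceptional`, `sparse_bound`), in
which the operator cut to the triple of an interval is compared with the operator cut to the triples
of small bad subintervals. The A_p condition and the maximal functions relative to w and to its dual
weight then give the ℓ^p(w) bound (`DualWeights.avg_mul_sum_le`, `strong_type_window`). Since A_1 is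
contained in A_2, this supplies an ℓ^2(w) bound for w in A_1, and a second use of the
Calderón-Zygmund step gives (ii).

The uniform finite bounds make the infinite matrix product converge on the weighted spaces. It
agrees with `T` on ℓ^r, so it is the required extension. -/

namespace LocalCZ

/-! ### Dyadic intervals, their triples and maximal families. -/

/-- The dyadic interval `[j 2 ^ k, (j + 1) 2 ^ k)`. -/
def dyadic (k j : ℕ) : Finset ℕ := Finset.Ico (j * 2 ^ k) ((j + 1) * 2 ^ k)

/-- The union of a dyadic interval and its (at most two) neighbours of the same length. -/
def triple (k j : ℕ) : Finset ℕ := Finset.Ico ((j - 1) * 2 ^ k) ((j + 2) * 2 ^ k)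

theorem mem_dyadic {k j x : ℕ} : x ∈ dyadic k j ↔ x / 2 ^ k = j := by
  rw [dyadic, Finset.mem_Ico, ← Nat.le_div_iff_mul_le (by positivity),
    ← Nat.div_lt_iff_lt_mul (by positivity)]
  omega

theorem mem_triple {k j x : ℕ} : x ∈ triple k j ↔ j ≤ x / 2 ^ k + 1 ∧ x / 2 ^ k ≤ j + 1 := by
  rw [triple, Finset.mem_Ico, ← Nat.le_div_iff_mul_le (by positivity),
    ← Nat.div_lt_iff_lt_mul (by positivity)]
  generalize x / 2 ^ k = a
  omega

theorem card_dyadic (k j : ℕ) : (dyadic k j).card = 2 ^ k := by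
  simp [dyadic, add_mul]

theorem card_triple_le (k j : ℕ) : (triple k j).card ≤ 3 * 2 ^ k := by
  rw [triple, Nat.card_Ico, ← Nat.sub_mul]
  gcongr
  omega

theorem mem_dyadic_self (k x : ℕ) : x ∈ dyadic k (x / 2 ^ k) := mem_dyadic.2 rfl

theorem dyadic_nonempty (k j : ℕ) : (dyadic k j).Nonempty := by
  rw [← Finset.card_pos, card_dyadic]
  positivity

theorem dyadic_subset_triple (k j : ℕ) : dyadic k j ⊆ triple k j := by
  intro x hx
  rw [mem_dyadic] at hx
  rw [mem_triple]
  omega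

theorem div_two_pow_div {k i : ℕ} (h : k ≤ i) (x : ℕ) : x / 2 ^ k / 2 ^ (i - k) = x / 2 ^ i := by
  rw [Nat.div_div_eq_div_mul, ← pow_add, Nat.add_sub_cancel' h]

theorem dyadic_subset_of_mem {k i x : ℕ} (h : k ≤ i) :
    dyadic k (x / 2 ^ k) ⊆ dyadic i (x / 2 ^ i) := by
  intro y hy
  rw [mem_dyadic] at hy ⊢
  rw [← div_two_pow_div h, hy, div_two_pow_div h]

theorem mem_triple_of_le {k i x y : ℕ} (h : k ≤ i) (hx : x ∈ triple k (y / 2 ^ k)) :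
    x ∈ triple i (y / 2 ^ i) := by
  rw [mem_triple] at hx ⊢
  rw [← div_two_pow_div h x, ← div_two_pow_div h y]
  set d := 2 ^ (i - k)
  have hd : 0 < d := by positivity
  constructor
  · calc y / 2 ^ k / d ≤ (x / 2 ^ k + d) / d := Nat.div_le_div_right (by omega)
      _ = _ := Nat.add_div_right _ hd
  · calc x / 2 ^ k / d ≤ (y / 2 ^ k + d) / d := Nat.div_le_div_right (by omega)
      _ = _ := Nat.add_div_right _ hd

theorem triple_subset_of_le {k i x : ℕ} (h : k ≤ i) :
    triple k (x / 2 ^ k) ⊆ triple i (x / 2 ^ i) := fun _ hy => mem_triple_of_le h hy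

theorem dyadic_subset_range {k N x : ℕ} (hk : k ≤ N) (hx : x < 2 ^ N) :
    dyadic k (x / 2 ^ k) ⊆ Finset.range (2 ^ N) := by
  intro y hy
  have := dyadic_subset_of_mem (x := x) hk hy
  rw [mem_dyadic, Nat.div_eq_of_lt hx, Nat.div_eq_zero_iff] at this
  rcases this with h | h
  · exact absurd h (by positivity)
  · simpa using h

/-- The family of maximal dyadic intervals in `[0, 2 ^ N)` with a given property. -/
theorem exists_maximal_dyadic (N : ℕ) (B : ℕ → ℕ → Prop) :
    ∃ 𝓜 : Finset (ℕ × ℕ),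
      (∀ P ∈ 𝓜, P.1 ≤ N ∧ B P.1 P.2 ∧ dyadic P.1 P.2 ⊆ Finset.range (2 ^ N) ∧
        ∀ x ∈ dyadic P.1 P.2, ∀ i, P.1 < i → i ≤ N → ¬ B i (x / 2 ^ i)) ∧
      (𝓜 : Set (ℕ × ℕ)).PairwiseDisjoint (fun P => dyadic P.1 P.2) ∧
      ∀ x < 2 ^ N, ∀ k ≤ N, B k (x / 2 ^ k) →
        ∃ P ∈ 𝓜, x ∈ dyadic P.1 P.2 ∧ k ≤ P.1 := by
  classical
  set 𝓜 : Finset (ℕ × ℕ) := ((Finset.range (N + 1)) ×ˢ (Finset.range (2 ^ N))).filter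
    (fun P => B P.1 P.2 ∧ dyadic P.1 P.2 ⊆ Finset.range (2 ^ N) ∧
        ∀ x ∈ dyadic P.1 P.2, ∀ i, P.1 < i → i ≤ N → ¬ B i (x / 2 ^ i)) with h𝓜
  have hmem : ∀ P ∈ 𝓜, P.1 ≤ N ∧ B P.1 P.2 ∧ dyadic P.1 P.2 ⊆ Finset.range (2 ^ N) ∧
        ∀ x ∈ dyadic P.1 P.2, ∀ i, P.1 < i → i ≤ N → ¬ B i (x / 2 ^ i) := by
    intro P hP
    rw [h𝓜, Finset.mem_filter, Finset.mem_product, Finset.mem_range] at hP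
    exact ⟨by omega, hP.2⟩
  have key : ∀ P ∈ 𝓜, ∀ R ∈ 𝓜, ∀ x, x ∈ dyadic P.1 P.2 → x ∈ dyadic R.1 R.2 → ¬ P.1 < R.1 := by
    intro P hP R hR x hxP hxR hlt
    refine (hmem P hP).2.2.2 x hxP R.1 hlt (hmem R hR).1 ?_
    rw [mem_dyadic.1 hxR]
    exact (hmem R hR).2.1
  refine ⟨𝓜, hmem, ?_, ?_⟩
  · intro P hP R hR hne
    rw [Function.onFun, Finset.disjoint_left]
    intro x hxP hxR
    have h1 := key P hP R hR x hxP hxR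
    have h2 := key R hR P hP x hxR hxP
    have h3 : P.1 = R.1 := by omega
    refine hne (Prod.ext h3 ?_)
    rw [← mem_dyadic.1 hxP, ← mem_dyadic.1 hxR, h3]
  · intro x hx k hk hB
    -- The largest level at which the interval through x has the property gives the maximal
    -- interval.
    set s := (Finset.range (N + 1)).filter (fun i => B i (x / 2 ^ i)) with hs
    have hks : k ∈ s := by
      rw [hs, Finset.mem_filter, Finset.mem_range]
      exact ⟨by omega, hB⟩
    have hne : s.Nonempty := ⟨k, hks⟩
    obtain ⟨hi1, hi2⟩ := Finset.mem_filter.1 (s.max'_mem hne)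
    rw [Finset.mem_range] at hi1
    refine ⟨(s.max' hne, x / 2 ^ s.max' hne), ?_, mem_dyadic_self _ _, s.le_max' k hks⟩
    rw [h𝓜, Finset.mem_filter, Finset.mem_product, Finset.mem_range, Finset.mem_range]
    refine ⟨⟨hi1, (Nat.div_le_self _ _).trans_lt hx⟩, hi2,
      dyadic_subset_range (by omega) hx, ?_⟩
    intro y hy i hlt hiN hBi
    have hyx : y / 2 ^ i = x / 2 ^ i := by
      rw [← div_two_pow_div hlt.le, mem_dyadic.1 hy, div_two_pow_div hlt.le]
    rw [hyx] at hBi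
    have : i ∈ s := by
      rw [hs, Finset.mem_filter, Finset.mem_range]
      exact ⟨by omega, hBi⟩
    exact absurd (s.le_max' i this) (not_le.2 hlt)

theorem mem_triple_of_abs_lt {i x y : ℕ} (h : |(x : ℝ) - y| < 2 ^ i) : x ∈ triple i (y / 2 ^ i) := by
  rw [abs_lt] at h
  have h1 : y < x + 2 ^ i := by
    have : (y : ℝ) < x + 2 ^ i := by linarith
    exact_mod_cast this
  have h2 : x < y + 2 ^ i := by
    have : (x : ℝ) < y + 2 ^ i := by linarith
    exact_mod_cast this
  rw [mem_triple]
  constructor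
  · calc y / 2 ^ i ≤ (x + 2 ^ i) / 2 ^ i := Nat.div_le_div_right h1.le
      _ = _ := Nat.add_div_right _ (by positivity)
  · calc x / 2 ^ i ≤ (y + 2 ^ i) / 2 ^ i := Nat.div_le_div_right h2.le
      _ = _ := Nat.add_div_right _ (by positivity)

theorem two_pow_le_abs_of_notMem_triple {k x m : ℕ} (h : m ∉ triple k (x / 2 ^ k)) :
    (2 : ℝ) ^ k ≤ |(m : ℝ) - x| := by
  by_contra hc
  exact h (mem_triple_of_abs_lt (not_le.1 hc))

/-! ### Poisson and Hardy sums against averages over triples. -/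

/-- A sum against the Poisson-like kernel is controlled by the averages over triples. -/
theorem sum_poisson_le {N k y : ℕ} (hy : y < 2 ^ N) {φ : ℕ → ℝ} (hφ : ∀ n, 0 ≤ φ n) {Λ : ℝ}
    (hΛ : 0 ≤ Λ) (h : ∀ i ≤ N, ∑ n ∈ triple i (y / 2 ^ i), φ n ≤ 2 ^ i * Λ) {s : Finset ℕ}
    (hs : s ⊆ Finset.range (2 ^ N)) (hsk : ∀ n ∈ s, (2 : ℝ) ^ k ≤ |(n : ℝ) - y|) :
    ∑ n ∈ s, 2 ^ k / |(n : ℝ) - y| ^ 2 * φ n ≤ 4 * Λ := by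
  classical
  -- A point at distance d from y is charged to the scale i with 2^(i-1) ≤ d < 2^i: it lies in the
  -- triple of that scale and 1/d^2 ≤ 4/4^i. The averages then leave the geometric series of 2^k /
  -- 2^i over i > k, whose sum is at most 1.
  have hpt : ∀ n ∈ s, 2 ^ k / |(n : ℝ) - y| ^ 2 * φ n ≤
      ∑ i ∈ Finset.Ioc k N, if n ∈ triple i (y / 2 ^ i) then 4 * 2 ^ k / (2 ^ i) ^ 2 * φ n
        else 0 := by
    intro n hn
    set d : ℕ := (n - y) + (y - n) with hd
    have hdabs : |(n : ℝ) - y| = d := by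
      rcases le_total n y with h1 | h1
      · rw [abs_of_nonpos (by simpa using h1), hd, Nat.sub_eq_zero_of_le h1]
        push_cast [h1]
        ring
      · rw [abs_of_nonneg (by simpa using h1), hd, Nat.sub_eq_zero_of_le h1]
        push_cast [h1]
        ring
    have hkd : 2 ^ k ≤ d := by
      have := hsk n hn
      rw [hdabs] at this
      exact_mod_cast this
    have hd0 : d ≠ 0 := by
      have : 0 < 2 ^ k := by positivity
      omega
    have hdN : d < 2 ^ N := by
      have := Finset.mem_range.1 (hs hn)
      omega
    have hlog1 : 2 ^ (Nat.log 2 d) ≤ d := Nat.pow_log_le_self 2 hd0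
    have hlog2 : d < 2 ^ (Nat.log 2 d + 1) := Nat.lt_pow_succ_log_self (by norm_num) d
    have hk1 : k ≤ Nat.log 2 d := Nat.le_log_of_pow_le (by norm_num) hkd
    have hN1 : Nat.log 2 d < N := Nat.log_lt_of_lt_pow hd0 hdN
    have hi : Nat.log 2 d + 1 ∈ Finset.Ioc k N := by
      rw [Finset.mem_Ioc]; omega
    have hnt : n ∈ triple (Nat.log 2 d + 1) (y / 2 ^ (Nat.log 2 d + 1)) := by
      apply mem_triple_of_abs_lt
      rw [hdabs]
      exact_mod_cast hlog2
    refine le_trans ?_ (Finset.single_le_sum (f := fun i =>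
      if n ∈ triple i (y / 2 ^ i) then 4 * 2 ^ k / (2 ^ i) ^ 2 * φ n else (0 : ℝ)) ?_ hi)
    · rw [if_pos hnt, hdabs]
      refine mul_le_mul_of_nonneg_right ?_ (hφ n)
      have h3 : (2 : ℝ) ^ (Nat.log 2 d) ≤ d := by exact_mod_cast hlog1
      have h4 : (0 : ℝ) < 2 ^ (Nat.log 2 d) := by positivity
      have h6 : (0 : ℝ) < 2 ^ k := by positivity
      have h7 : (0 : ℝ) < d := h4.trans_le h3
      rw [div_le_div_iff₀ (by positivity) (by positivity), pow_succ (2 : ℝ) (Nat.log 2 d)]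
      have h5 : ((2 : ℝ) ^ (Nat.log 2 d)) ^ 2 ≤ (d : ℝ) ^ 2 := by gcongr
      nlinarith
    · intro i _
      split_ifs
      · exact mul_nonneg (by positivity) (hφ n)
      · exact le_rfl
  calc ∑ n ∈ s, 2 ^ k / |(n : ℝ) - y| ^ 2 * φ n
      ≤ ∑ n ∈ s, ∑ i ∈ Finset.Ioc k N,
          if n ∈ triple i (y / 2 ^ i) then 4 * 2 ^ k / (2 ^ i) ^ 2 * φ n else 0 :=
        Finset.sum_le_sum hpt
    _ = ∑ i ∈ Finset.Ioc k N, ∑ n ∈ s,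
          if n ∈ triple i (y / 2 ^ i) then 4 * 2 ^ k / (2 ^ i) ^ 2 * φ n else 0 :=
        Finset.sum_comm
    _ ≤ ∑ i ∈ Finset.Ioc k N, 4 * 2 ^ k / 2 ^ i * Λ := by
        refine Finset.sum_le_sum fun i hi => ?_
        rw [← Finset.sum_filter, ← Finset.mul_sum]
        have h1 : ∑ n ∈ s with n ∈ triple i (y / 2 ^ i), φ n ≤ 2 ^ i * Λ := by
          refine le_trans (Finset.sum_le_sum_of_subset_of_nonneg ?_ fun n _ _ => hφ n)
            (h i (Finset.mem_Ioc.1 hi).2)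
          intro n hn
          exact (Finset.mem_filter.1 hn).2
        calc 4 * 2 ^ k / (2 ^ i) ^ 2 * ∑ n ∈ s with n ∈ triple i (y / 2 ^ i), φ n
            ≤ 4 * 2 ^ k / (2 ^ i) ^ 2 * (2 ^ i * Λ) := by gcongr
          _ = _ := by field_simp
    _ = 4 * Λ * ∑ i ∈ Finset.Ioc k N, (2 : ℝ) ^ k / 2 ^ i := by
        rw [Finset.mul_sum]
        refine Finset.sum_congr rfl fun i _ => ?_
        ring
    _ ≤ 4 * Λ * 1 := by
        gcongr
        have : ∀ M, k ≤ M → ∑ i ∈ Finset.Ioc k M, (2 : ℝ) ^ k / 2 ^ i = 1 - 2 ^ k / 2 ^ M := by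
          intro M hM
          induction M, hM using Nat.le_induction with
          | base => simp
          | succ M hM ih =>
            rw [← Finset.insert_Ioc_right_eq_Ioc_add_one (by omega), Finset.sum_insert (by simp), ih, pow_succ]
            field_simp
            ring
        rcases le_total k N with hkN | hkN
        · rw [this N hkN]
          have : (0 : ℝ) ≤ 2 ^ k / 2 ^ N := by positivity
          linarith
        · rw [Finset.Ioc_eq_empty (by omega)]
          simp
    _ = 4 * Λ := mul_one _

/-- If 2^i ≤ y + 1 < 2^(i+1), then y lies in one of the first two intervals of length 2^i, so its
triple contains [0, y]. The Hardy average is thus dominated by one triple average. -/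
theorem sum_hardy_le {N y : ℕ} (hy : y < 2 ^ N) {φ : ℕ → ℝ} (hφ : ∀ n, 0 ≤ φ n) {Λ : ℝ}
    (hΛ : 0 ≤ Λ) (h : ∀ i ≤ N, ∑ n ∈ triple i (y / 2 ^ i), φ n ≤ 2 ^ i * Λ) :
    ∑ n ∈ Finset.range (y + 1), φ n / ((y : ℝ) + 1) ≤ Λ := by
  set i := Nat.log 2 (y + 1) with hi
  have h1 : 2 ^ i ≤ y + 1 := Nat.pow_log_le_self 2 (by omega)
  have h2 : y + 1 < 2 ^ (i + 1) := Nat.lt_pow_succ_log_self (by norm_num) _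
  have hiN : i ≤ N := by
    have : 2 ^ i ≤ 2 ^ N := by omega
    exact (Nat.pow_le_pow_iff_right (by norm_num)).1 this
  have hyi : y / 2 ^ i ≤ 1 := by
    rw [← Nat.lt_succ_iff, Nat.div_lt_iff_lt_mul (by positivity)]
    rw [pow_succ] at h2
    omega
  have hsub : Finset.range (y + 1) ⊆ triple i (y / 2 ^ i) := by
    intro m hm
    rw [Finset.mem_range] at hm
    rw [mem_triple]
    have : m / 2 ^ i ≤ y / 2 ^ i := Nat.div_le_div_right (by omega)
    revert this hyi
    generalize y / 2 ^ i = a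
    generalize m / 2 ^ i = b
    omega
  rw [← Finset.sum_div, div_le_iff₀ (by positivity)]
  have h3 : (2 : ℝ) ^ i ≤ y + 1 := by exact_mod_cast h1
  calc ∑ n ∈ Finset.range (y + 1), φ n ≤ ∑ n ∈ triple i (y / 2 ^ i), φ n :=
        Finset.sum_le_sum_of_subset_of_nonneg hsub fun n _ _ => hφ n
    _ ≤ 2 ^ i * Λ := h i hiN
    _ ≤ Λ * (y + 1) := by rw [mul_comm]; gcongr

/-! ### The maximal function relative to a doubling measure. -/

theorem triple_eq_biUnion (k j : ℕ) :
    triple k j = (Finset.Icc (j - 1) (j + 1)).biUnion (dyadic k) := by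
  ext x
  simp only [Finset.mem_biUnion, Finset.mem_Icc, mem_dyadic, mem_triple]
  generalize x / 2 ^ k = a
  constructor
  · intro h
    exact ⟨a, by omega, rfl⟩
  · rintro ⟨b, hb, rfl⟩
    omega

theorem pairwiseDisjoint_dyadic (k : ℕ) (s : Set ℕ) : s.PairwiseDisjoint (dyadic k) := by
  intro i _ j _ hij
  rw [Function.onFun, Finset.disjoint_left]
  intro x hx hy
  exact hij ((mem_dyadic.1 hx).symm.trans (mem_dyadic.1 hy))

theorem sum_triple (k j : ℕ) (f : ℕ → ℝ) :
    ∑ x ∈ triple k j, f x = ∑ i ∈ Finset.Icc (j - 1) (j + 1), ∑ x ∈ dyadic k i, f x := by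
  rw [triple_eq_biUnion, Finset.sum_biUnion (pairwiseDisjoint_dyadic _ _)]

theorem sum_biUnion_le {ι : Type*} (s : Finset ι) (t : ι → Finset ℕ) {f : ℕ → ℝ}
    (hf : ∀ n, 0 ≤ f n) : ∑ x ∈ s.biUnion t, f x ≤ ∑ i ∈ s, ∑ x ∈ t i, f x := by
  classical
  induction s using Finset.induction_on with
  | empty => simp
  | insert i s hi ih =>
    rw [Finset.biUnion_insert, Finset.sum_insert hi]
    have := Finset.sum_union_inter (s₁ := t i) (s₂ := s.biUnion t) (f := f)
    have h2 : 0 ≤ ∑ x ∈ t i ∩ s.biUnion t, f x := Finset.sum_nonneg fun x _ => hf x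
    linarith

/-- Weak type bound for the triple maximal function relative to a doubling measure. -/
theorem weak_maximal {μ : ℕ → ℝ} (hμ : ∀ n, 0 ≤ μ n) {D : ℝ} (hD0 : 0 ≤ D)
    (hD : ∀ k j, ∑ x ∈ triple k j, μ x ≤ D * ∑ x ∈ dyadic k j, μ x) {N : ℕ} {a : ℕ → ℝ}
    (ha : ∀ n, 0 ≤ a n) (haN : ∀ n, 2 ^ N ≤ n → a n = 0) {t : ℝ} (ht : 0 ≤ t) {s : Finset ℕ}
    (hst : ∀ x ∈ s, ∃ k ≤ N,
      t * ∑ y ∈ triple k (x / 2 ^ k), μ y < ∑ y ∈ triple k (x / 2 ^ k), a y) :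
    t * ∑ x ∈ s, μ x ≤ D * ∑ x ∈ Finset.range (2 ^ N), a x := by
  classical
  -- The stopping intervals are single dyadic intervals. If the mean over a triple exceeds t, so
  -- does the mean over one of its constituents; that one lies in a maximal interval, whose triple
  -- contains x. Disjointness and doubling then give the bound.
  obtain ⟨𝓜, h1, h2, h3⟩ := exists_maximal_dyadic N
    (fun k j => t * ∑ y ∈ dyadic k j, μ y < ∑ y ∈ dyadic k j, a y)
  have hcov : s ⊆ 𝓜.biUnion (fun P => triple P.1 P.2) := by
    intro x hx
    obtain ⟨k, hk, hlt⟩ := hst x hx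
    rw [sum_triple, sum_triple, Finset.mul_sum] at hlt
    obtain ⟨j, hj, hlt⟩ := Finset.exists_lt_of_sum_lt hlt
    have hpos : 0 < ∑ y ∈ dyadic k j, a y :=
      lt_of_le_of_lt (mul_nonneg ht (Finset.sum_nonneg fun y _ => hμ y)) hlt
    -- The constituent may lie beyond the window; a point where `a` is nonzero brings it back
    -- inside, where maximal intervals are available.
    obtain ⟨y, hy, hay⟩ := Finset.exists_ne_zero_of_sum_ne_zero hpos.ne'
    have hyN : y < 2 ^ N := by
      by_contra hc
      exact hay (haN y (not_lt.1 hc))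
    have hyj := mem_dyadic.1 hy
    rw [← hyj] at hlt
    obtain ⟨P, hP, hyP, hkP⟩ := h3 y hyN k hk hlt
    refine Finset.mem_biUnion.2 ⟨P, hP, ?_⟩
    rw [← mem_dyadic.1 hyP]
    apply mem_triple_of_le hkP
    rw [mem_triple, hyj]
    rw [Finset.mem_Icc] at hj
    omega
  calc t * ∑ x ∈ s, μ x ≤ t * ∑ x ∈ 𝓜.biUnion (fun P => triple P.1 P.2), μ x := by
        gcongr
        exact fun _ _ _ => hμ _
    _ ≤ t * ∑ P ∈ 𝓜, ∑ x ∈ triple P.1 P.2, μ x := by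
        gcongr
        exact sum_biUnion_le 𝓜 _ hμ
    _ ≤ t * ∑ P ∈ 𝓜, D * ∑ x ∈ dyadic P.1 P.2, μ x := by
        gcongr with P _
        exact hD _ _
    _ = D * ∑ P ∈ 𝓜, t * ∑ x ∈ dyadic P.1 P.2, μ x := by
        rw [Finset.mul_sum, Finset.mul_sum]
        refine Finset.sum_congr rfl fun P _ => ?_
        ring
    _ ≤ D * ∑ P ∈ 𝓜, ∑ x ∈ dyadic P.1 P.2, a x := by
        gcongr with P hP
        exact (h1 P hP).2.1.le
    _ = D * ∑ x ∈ 𝓜.biUnion (fun P => dyadic P.1 P.2), a x := by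
        rw [Finset.sum_biUnion h2]
    _ ≤ D * ∑ x ∈ Finset.range (2 ^ N), a x := by
        gcongr
        · exact fun _ _ _ => ha _
        · exact Finset.biUnion_subset.2 fun P hP => (h1 P hP).2.2.1

theorem integral_indicator_rpow {c s : ℝ} (hc : 0 ≤ c) (hs : -1 < s) :
    IntegrableOn ((Set.Iio c).indicator fun t : ℝ => t ^ s) (Set.Ioi 0) ∧
      ∫ t in Set.Ioi (0 : ℝ), (Set.Iio c).indicator (fun t : ℝ => t ^ s) t =
        c ^ (s + 1) / (s + 1) := by
  have hset : Set.Iio c ∩ Set.Ioi (0 : ℝ) = Set.Ioo 0 c := by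
    ext; simp [and_comm]
  constructor
  · rw [IntegrableOn, integrable_indicator_iff measurableSet_Iio, IntegrableOn,
      Measure.restrict_restrict measurableSet_Iio, hset]
    have := intervalIntegral.intervalIntegrable_rpow' (a := 0) (b := c) hs
    rw [intervalIntegrable_iff_integrableOn_Ioo_of_le hc] at this
    exact this
  · rw [integral_indicator measurableSet_Iio, Measure.restrict_restrict measurableSet_Iio, hset,
      ← integral_Ioc_eq_integral_Ioo, ← intervalIntegral.integral_of_le hc,
      integral_rpow (Or.inl hs), Real.zero_rpow (by linarith), sub_zero]

/-- A finite layer cake argument: from truncated weak type to strong type. -/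
theorem strong_of_weak {s : Finset ℕ} {μ u h : ℕ → ℝ} (hu : ∀ x, 0 ≤ u x)
    (hh : ∀ x, 0 ≤ h x) {D p : ℝ} (hp : 1 < p)
    (H : ∀ t > 0, t * ∑ x ∈ s with t < u x, μ x ≤ D * ∑ x ∈ s with t < 2 * h x, h x * μ x) :
    ∑ x ∈ s, u x ^ p * μ x ≤ p * D * 2 ^ (p - 1) / (p - 1) * ∑ x ∈ s, h x ^ p * μ x := by
  have hp1 : 0 < p - 1 := by linarith
  have e1 : ∫ t in Set.Ioi (0 : ℝ), ∑ x ∈ s,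
      μ x * (Set.Iio (u x)).indicator (fun t : ℝ => t ^ (p - 1)) t =
      ∑ x ∈ s, μ x * (u x ^ p / p) := by
    rw [integral_finsetSum _ fun x _ =>
      ((integral_indicator_rpow (hu x) (by linarith : -1 < p - 1)).1.const_mul _)]
    refine Finset.sum_congr rfl fun x _ => ?_
    rw [integral_const_mul, (integral_indicator_rpow (hu x) (by linarith)).2, sub_add_cancel]
  have e2 : ∫ t in Set.Ioi (0 : ℝ), ∑ x ∈ s,
      (D * (h x * μ x)) * (Set.Iio (2 * h x)).indicator (fun t : ℝ => t ^ (p - 2)) t =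
      ∑ x ∈ s, (D * (h x * μ x)) * ((2 * h x) ^ (p - 1) / (p - 1)) := by
    rw [integral_finsetSum _ fun x _ => ((integral_indicator_rpow (mul_nonneg zero_le_two (hh x))
      (by linarith : -1 < p - 2)).1.const_mul _)]
    refine Finset.sum_congr rfl fun x _ => ?_
    rw [integral_const_mul, (integral_indicator_rpow (mul_nonneg zero_le_two (hh x))
      (by linarith)).2, show p - 2 + 1 = p - 1 by ring]
  have e3 : ∑ x ∈ s, μ x * (u x ^ p / p) ≤
      ∑ x ∈ s, (D * (h x * μ x)) * ((2 * h x) ^ (p - 1) / (p - 1)) := by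
    rw [← e1, ← e2]
    -- The hypothesis at height t is multiplied by t^(p-2) and integrated in t; the right side
    -- yields (2h)^(p-1) / (p-1), hence the constant.
    refine setIntegral_mono_on ?_ ?_ measurableSet_Ioi fun t ht => ?_
    · exact integrable_finsetSum _ fun x _ =>
        ((integral_indicator_rpow (hu x) (by linarith : -1 < p - 1)).1.const_mul _)
    · exact integrable_finsetSum _ fun x _ =>
        ((integral_indicator_rpow (mul_nonneg zero_le_two (hh x))
          (by linarith : -1 < p - 2)).1.const_mul _)
    · have ht0 : 0 < t := ht
      have ht1 : t ^ (p - 1) = t ^ (p - 2) * t := by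
        rw [← Real.rpow_add_one ht0.ne']
        congr 1
        ring
      calc ∑ x ∈ s, μ x * (Set.Iio (u x)).indicator (fun t : ℝ => t ^ (p - 1)) t
          = t ^ (p - 2) * (t * ∑ x ∈ s with t < u x, μ x) := by
            rw [← mul_assoc, ← ht1, Finset.sum_filter, Finset.mul_sum]
            refine Finset.sum_congr rfl fun x _ => ?_
            simp only [Set.indicator_apply, Set.mem_Iio]
            split_ifs <;> ring
        _ ≤ t ^ (p - 2) * (D * ∑ x ∈ s with t < 2 * h x, h x * μ x) := by
            exact mul_le_mul_of_nonneg_left (H t ht0) (by positivity)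
        _ = _ := by
            rw [Finset.sum_filter, Finset.mul_sum, Finset.mul_sum]
            refine Finset.sum_congr rfl fun x _ => ?_
            simp only [Set.indicator_apply, Set.mem_Iio]
            split_ifs <;> ring
  have e4 : ∑ x ∈ s, u x ^ p * μ x = p * ∑ x ∈ s, μ x * (u x ^ p / p) := by
    rw [Finset.mul_sum]
    refine Finset.sum_congr rfl fun x _ => ?_
    field_simp
  have e5 : p * D * 2 ^ (p - 1) / (p - 1) * ∑ x ∈ s, h x ^ p * μ x =
      p * ∑ x ∈ s, (D * (h x * μ x)) * ((2 * h x) ^ (p - 1) / (p - 1)) := by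
    rw [Finset.mul_sum, Finset.mul_sum]
    refine Finset.sum_congr rfl fun x _ => ?_
    have : h x ^ p = h x ^ (p - 1) * h x := by
      rcases (hh x).eq_or_lt with h0 | h0
      · rw [← h0, Real.zero_rpow (by linarith), mul_zero]
      · rw [← Real.rpow_add_one h0.ne', sub_add_cancel]
    rw [this, Real.mul_rpow zero_le_two (hh x)]
    ring
  rw [e4, e5]
  gcongr

/-- The maximal function over triples of dyadic intervals, relative to the measure `μ`. -/
noncomputable def tripleMax (μ a : ℕ → ℝ) (N x : ℕ) : ℝ :=
  (Finset.range (N + 1)).sup' Finset.nonempty_range_add_one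
    fun k => (∑ y ∈ triple k (x / 2 ^ k), a y) / ∑ y ∈ triple k (x / 2 ^ k), μ y

theorem le_tripleMax (μ a : ℕ → ℝ) {N k : ℕ} (hk : k ≤ N) (x : ℕ) :
    (∑ y ∈ triple k (x / 2 ^ k), a y) / ∑ y ∈ triple k (x / 2 ^ k), μ y ≤ tripleMax μ a N x :=
  Finset.le_sup' (fun k => (∑ y ∈ triple k (x / 2 ^ k), a y) / ∑ y ∈ triple k (x / 2 ^ k), μ y)
    (Finset.mem_range.2 (Nat.lt_succ_of_le hk))

theorem tripleMax_nonneg {μ a : ℕ → ℝ} (hμ : ∀ n, 0 ≤ μ n) (ha : ∀ n, 0 ≤ a n) (N x : ℕ) :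
    0 ≤ tripleMax μ a N x :=
  (div_nonneg (Finset.sum_nonneg fun _ _ => ha _) (Finset.sum_nonneg fun _ _ => hμ _)).trans
    (le_tripleMax μ a (Nat.zero_le N) x)

theorem sum_triple_pos {μ : ℕ → ℝ} (hμ : ∀ n, 0 < μ n) (k j : ℕ) : 0 < ∑ x ∈ triple k j, μ x :=
  Finset.sum_pos (fun x _ => hμ x) ((dyadic_nonempty k j).mono (dyadic_subset_triple k j))

/-- Marcinkiewicz truncation: the part of `a` where a/μ ≤ t/2 contributes at most t/2 to every
average, so above height t only the remaining part matters, and the weak bound is applied to it at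
height t/2. This is the source of the factor 2 in front of `D`. -/
theorem strong_maximal {μ : ℕ → ℝ} (hμ : ∀ n, 0 < μ n) {D : ℝ} (hD0 : 0 ≤ D)
    (hD : ∀ k j, ∑ x ∈ triple k j, μ x ≤ D * ∑ x ∈ dyadic k j, μ x) {p : ℝ} (hp : 1 < p)
    {N : ℕ} {a : ℕ → ℝ} (ha : ∀ n, 0 ≤ a n) (haN : ∀ n, 2 ^ N ≤ n → a n = 0) :
    ∑ x ∈ Finset.range (2 ^ N), tripleMax μ a N x ^ p * μ x ≤
      p * (2 * D) * 2 ^ (p - 1) / (p - 1) *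
        ∑ x ∈ Finset.range (2 ^ N), (a x / μ x) ^ p * μ x := by
  refine strong_of_weak (tripleMax_nonneg (fun n => (hμ n).le) ha N)
    (fun x => div_nonneg (ha x) (hμ x).le) hp fun t ht => ?_
  set a' : ℕ → ℝ := fun x => if t < 2 * (a x / μ x) then a x else 0 with ha'
  have key := weak_maximal (fun n => (hμ n).le) hD0 hD (N := N) (a := a')
    (fun n => by rw [ha']; dsimp only; split_ifs; exacts [ha n, le_rfl])
    (fun n hn => by rw [ha']; dsimp only; rw [haN n hn, ite_self]) (t := t / 2) (by positivity)
    (s := {x ∈ Finset.range (2 ^ N) | t < tripleMax μ a N x}) ?_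
  · have : ∑ x ∈ Finset.range (2 ^ N), a' x =
        ∑ x ∈ Finset.range (2 ^ N) with t < 2 * (a x / μ x), a x / μ x * μ x := by
      rw [Finset.sum_filter]
      refine Finset.sum_congr rfl fun x _ => ?_
      rw [ha', div_mul_cancel₀ _ (hμ x).ne']
    rw [this] at key
    linarith
  · intro x hx
    obtain ⟨k, hk, hlt⟩ := (Finset.lt_sup'_iff _).1 (Finset.mem_filter.1 hx).2
    refine ⟨k, by rw [Finset.mem_range] at hk; omega, ?_⟩
    rw [lt_div_iff₀ (sum_triple_pos hμ _ _)] at hlt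
    have h1 : ∑ y ∈ triple k (x / 2 ^ k), a y ≤
        ∑ y ∈ triple k (x / 2 ^ k), a' y + t / 2 * ∑ y ∈ triple k (x / 2 ^ k), μ y := by
      rw [Finset.mul_sum, ← Finset.sum_add_distrib]
      refine Finset.sum_le_sum fun y _ => ?_
      rw [ha']
      dsimp only
      have := (hμ y).le
      split_ifs with hy
      · have : 0 ≤ t / 2 * μ y := by positivity
        linarith
      · rw [not_lt, ← mul_div_assoc, div_le_iff₀ (hμ y)] at hy
        linarith
    linarith

/-! ### Oscillation of a local standard kernel. -/

variable {𝕜 E F : Type*} [RCLike 𝕜] [NormedAddCommGroup E] [NormedSpace 𝕜 E]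
    [NormedAddCommGroup F] [NormedSpace 𝕜 F]

/-- The majorant for the oscillation of a local standard kernel over a dyadic interval of length
`2 ^ k` containing `y`, seen from a point `m` outside of the triple of that interval. -/
noncomputable def oscMajorant (k y m : ℕ) : ℝ :=
  2 ^ k / |(m : ℝ) - y| ^ 2 + 1 / (max (y : ℝ) m + 1)

/-- The size and oscillation bounds on the first variable of a kernel. -/
theorem norm_sub_le_oscMajorant {G : Type*} [SeminormedAddCommGroup G] {κ : ℕ → ℕ → G} {C : ℝ}
    (hC : 0 < C)
    (hsize : ∀ n m : ℕ, n ≠ m → ‖κ n m‖ ≤ C / |(n : ℝ) - m|)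
    (hreg : ∀ n m l : ℕ, |(n : ℝ) - m| > 2 * |(n : ℝ) - l| →
      (m : ℝ) / 2 < n → (n : ℝ) < 3 * m / 2 → (m : ℝ) / 2 < l → (l : ℝ) < 3 * m / 2 →
      ‖κ n m - κ l m‖ ≤ C * (|(n : ℝ) - l| / |(n : ℝ) - m| ^ 2))
    {k x y m : ℕ} (hxy : x / 2 ^ k = y / 2 ^ k) (hm : m ∉ triple k (y / 2 ^ k)) :
    ‖κ x m - κ y m‖ ≤ 18 * C * oscMajorant k y m := by
  have he : (2 : ℝ) ^ k ≤ |(y : ℝ) - m| := by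
    rw [abs_sub_comm]
    exact two_pow_le_abs_of_notMem_triple hm
  have hd : (2 : ℝ) ^ k ≤ |(x : ℝ) - m| := by
    rw [abs_sub_comm]
    exact two_pow_le_abs_of_notMem_triple (hxy ▸ hm)
  have hxyL : |(x : ℝ) - y| ≤ 2 ^ k := by
    have h1 := mem_dyadic_self k x
    have h2 := mem_dyadic_self k y
    rw [hxy, dyadic, Finset.mem_Ico] at h1
    rw [dyadic, Finset.mem_Ico] at h2
    have h3 : x ≤ y + 2 ^ k := by rw [add_mul] at h1; omega
    have h4 : y ≤ x + 2 ^ k := by rw [add_mul] at h2; omega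
    have h5 : (x : ℝ) ≤ y + 2 ^ k := by exact_mod_cast h3
    have h6 : (y : ℝ) ≤ x + 2 ^ k := by exact_mod_cast h4
    rw [abs_le]
    constructor <;> linarith
  have hL : (1 : ℝ) ≤ 2 ^ k := one_le_pow₀ (by norm_num)
  have hxm : x ≠ m := by
    rintro rfl
    simp at hd
    linarith
  have hym : y ≠ m := by
    rintro rfl
    simp at he
    linarith
  have hsx := hsize x m hxm
  have hsy := hsize y m hym
  have hreg' := hreg x m y
  have hmax0 : (0 : ℝ) ≤ max (y : ℝ) m := le_max_of_le_left (Nat.cast_nonneg y)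
  have hX : (0 : ℝ) ≤ x := Nat.cast_nonneg x
  have hY : (0 : ℝ) ≤ y := Nat.cast_nonneg y
  have hM : (0 : ℝ) ≤ m := Nat.cast_nonneg m
  have htri : ‖κ x m - κ y m‖ ≤ ‖κ x m‖ + ‖κ y m‖ := norm_sub_le _ _
  rw [oscMajorant, abs_sub_comm (m : ℝ)]
  have hde : |(x : ℝ) - m| ≤ |(x : ℝ) - y| + |(y : ℝ) - m| := abs_sub_le _ _ _
  have hed : |(y : ℝ) - m| ≤ |(x : ℝ) - y| + |(x : ℝ) - m| := by
    rw [abs_sub_comm (x : ℝ) y]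
    exact abs_sub_le _ _ _
  have hdx := le_abs_self ((x : ℝ) - m)
  have hdx' := neg_abs_le ((x : ℝ) - m)
  have hey := le_abs_self ((y : ℝ) - m)
  have hey' := neg_abs_le ((y : ℝ) - m)
  have hxy0 := abs_nonneg ((x : ℝ) - y)
  set d := |(x : ℝ) - m|
  set e := |(y : ℝ) - m|
  set L : ℝ := 2 ^ k
  have hd0 : 0 < d := by linarith
  have he0 : 0 < e := by linarith
  have hp1 : 0 ≤ 18 * C * (1 / (max (y : ℝ) m + 1)) := by positivity
  have hp2 : 0 ≤ 18 * C * (L / e ^ 2) := by positivity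
  -- Three cases. Far from m and in the local region, regularity applies, with e ≤ 2d. Far but not
  -- local, m ≤ 4e, so max(y, m) + 1 ≤ 6e and the two size bounds, at most 3C/e together, give 18 =
  -- 3 · 6. Near m, e ≤ 3L, and the size bounds 2C/L give 18 = 2 · 9.
  by_cases h1 : d > 2 * |(x : ℝ) - y|
  · by_cases h2 : (m : ℝ) / 2 < x ∧ (x : ℝ) < 3 * m / 2 ∧ (m : ℝ) / 2 < y ∧ (y : ℝ) < 3 * m / 2
    · have h3 := hreg' h1 h2.1 h2.2.1 h2.2.2.1 h2.2.2.2
      have h4 : C * (|(x : ℝ) - y| / d ^ 2) ≤ 18 * C * (L / e ^ 2) := by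
        have : |(x : ℝ) - y| / d ^ 2 ≤ 18 * (L / e ^ 2) := by
          rw [← mul_div_assoc, div_le_div_iff₀ (by positivity) (by positivity)]
          have : e ^ 2 ≤ (2 * d) ^ 2 := by gcongr; linarith
          have h6 : 0 ≤ L := by linarith
          have h7 : |(x : ℝ) - y| * e ^ 2 ≤ L * (2 * d) ^ 2 := by gcongr
          have h8 : 0 ≤ L * d ^ 2 := by positivity
          linarith
        calc C * (|(x : ℝ) - y| / d ^ 2) ≤ C * (18 * (L / e ^ 2)) := by gcongr
          _ = _ := by ring
      linarith
    · have h3 : (m : ℝ) ≤ 4 * e := by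
        by_contra hc
        apply h2
        refine ⟨?_, ?_, ?_, ?_⟩ <;> linarith
      have h4 : max (y : ℝ) m + 1 ≤ 6 * e := by
        have : max (y : ℝ) m ≤ 5 * e := max_le (by linarith) (by linarith)
        linarith
      have h5 : C / d ≤ 2 * (C / e) := by
        rw [← mul_div_assoc, div_le_div_iff₀ hd0 he0]
        nlinarith
      have h6 : 3 * (C / e) ≤ 18 * C * (1 / (max (y : ℝ) m + 1)) := by
        rw [← mul_div_assoc, ← mul_div_assoc, div_le_div_iff₀ he0 (by positivity)]
        nlinarith
      linarith
  · have h3 : e ≤ 3 * L := by linarith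
    have h4 : C / d ≤ C / L := by gcongr
    have h5 : C / e ≤ C / L := by gcongr
    have h6 : 2 * (C / L) ≤ 18 * C * (L / e ^ 2) := by
      rw [← mul_div_assoc, ← mul_div_assoc, div_le_div_iff₀ (by linarith) (by positivity)]
      have : e ^ 2 ≤ (3 * L) ^ 2 := by gcongr
      nlinarith
    linarith

/-- Oscillation bounds of a (matrix) kernel in both variables over dyadic intervals. -/
structure HasOscBound (K : ℕ → ℕ → E →L[𝕜] F) (C : ℝ) : Prop where
  left : ∀ {k x y m : ℕ}, x / 2 ^ k = y / 2 ^ k → m ∉ triple k (y / 2 ^ k) →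
    ‖K x m - K y m‖ ≤ C * oscMajorant k y m
  right : ∀ {k x y m : ℕ}, x / 2 ^ k = y / 2 ^ k → m ∉ triple k (y / 2 ^ k) →
    ‖K m x - K m y‖ ≤ C * oscMajorant k y m

theorem exists_hasOscBound {K : ℕ → ℕ → E →L[𝕜] F} (hK : IsLocalStandardKernel K) :
    ∃ C, 0 < C ∧ HasOscBound K C := by
  obtain ⟨C, hC, h1, h2, h3⟩ := hK
  refine ⟨18 * C, by positivity, ⟨?_, ?_⟩⟩
  · intro k x y m
    exact norm_sub_le_oscMajorant hC h1 h2
  · intro k x y m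
    exact norm_sub_le_oscMajorant (κ := fun n m => K m n) hC
      (fun n m hnm => by rw [abs_sub_comm]; exact h1 m n hnm.symm) h3

/-! ### `A_1` weights and the Calderón-Zygmund decomposition. -/

theorem chebyshev_sum {s : Finset ℕ} {w X : ℕ → ℝ} (hw : ∀ n, 0 ≤ w n) (hX : ∀ n, 0 ≤ X n)
    (τ : ℝ) : τ * ∑ n ∈ s with τ < X n, w n ≤ ∑ n ∈ s, X n * w n := by
  rw [Finset.sum_filter, Finset.mul_sum]
  refine Finset.sum_le_sum fun n _ => ?_
  split_ifs with h
  · exact mul_le_mul_of_nonneg_right h.le (hw n)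
  · rw [mul_zero]
    exact mul_nonneg (hX n) (hw n)

/-- The `A_1` condition with constant `A`. -/
def A1Bound (w : ℕ → ℝ) (A : ℝ) : Prop :=
  ∀ a b : ℕ, ∀ x ∈ Finset.Ico a b,
    ∑ y ∈ Finset.Ico a b, w y ≤ A * (Finset.Ico a b).card * w x

theorem A1Bound.one_le {w : ℕ → ℝ} (hw : ∀ n, 0 < w n) {A : ℝ} (hA : A1Bound w A) : 1 ≤ A := by
  have h := hA 0 1 0 (by simp)
  have h0 := hw 0
  simp at h
  by_contra hc
  nlinarith

/-- The pointwise lower bound on the weight, summed against `c`. It trades the plain mass of `c` for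
its weighted mass, which is how stopping conditions on unweighted averages become weighted
estimates. -/
theorem A1Bound.sum_mul_sum_le {w : ℕ → ℝ} {A : ℝ} (hA : A1Bound w A) {a b : ℕ} {s : Finset ℕ}
    (hs : s ⊆ Finset.Ico a b) {c : ℕ → ℝ} (hc : ∀ n, 0 ≤ c n) :
    (∑ x ∈ s, c x) * ∑ y ∈ Finset.Ico a b, w y ≤
      A * (Finset.Ico a b).card * ∑ x ∈ s, c x * w x := by
  rw [Finset.sum_mul, Finset.mul_sum]
  refine Finset.sum_le_sum fun x hx => ?_
  calc c x * ∑ y ∈ Finset.Ico a b, w y ≤ c x * (A * (Finset.Ico a b).card * w x) :=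
        mul_le_mul_of_nonneg_left (hA a b x (hs hx)) (hc x)
    _ = _ := by ring

/-- Weak type bound of the Hardy averages for an `A_1` weight. -/
theorem weak_hardy {w : ℕ → ℝ} (hw : ∀ n, 0 < w n) {A : ℝ} (hA : A1Bound w A) {M : ℕ}
    {c : ℕ → ℝ} (hc : ∀ n, 0 ≤ c n) {τ : ℝ} (hτ : 0 ≤ τ) {s : Finset ℕ} (hs : s ⊆ Finset.range M)
    (hst : ∀ n ∈ s, τ < ∑ m ∈ Finset.range (n + 1), c m / ((n : ℝ) + 1)) :
    τ * ∑ n ∈ s, w n ≤ A * ∑ m ∈ Finset.range M, c m * w m := by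
  have hA1 := hA.one_le hw
  rcases s.eq_empty_or_nonempty with rfl | hne
  · rw [Finset.sum_empty, mul_zero]
    exact mul_nonneg (by linarith) (Finset.sum_nonneg fun n _ => mul_nonneg (hc n) (hw n).le)
  -- No covering is needed: all of s lies in [0, n] for its largest point n, and the Hardy average
  -- at n alone suffices.
  · set n := s.max' hne with hn
    have hns : n ∈ s := s.max'_mem hne
    have h1 := hst n hns
    rw [← Finset.sum_div, lt_div_iff₀ (by positivity)] at h1
    have hsub : s ⊆ Finset.Ico 0 (n + 1) := by
      intro x hx
      rw [Finset.mem_Ico]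
      exact ⟨Nat.zero_le _, Nat.lt_succ_of_le (s.le_max' x hx)⟩
    have h2 := hA.sum_mul_sum_le (s := Finset.range (n + 1)) (a := 0) (b := n + 1)
      (by rw [Finset.range_eq_Ico]) hc
    rw [Nat.card_Ico, Nat.sub_zero] at h2
    push_cast at h2
    have h3 : ∑ x ∈ s, w x ≤ ∑ x ∈ Finset.Ico 0 (n + 1), w x :=
      Finset.sum_le_sum_of_subset_of_nonneg hsub fun x _ _ => (hw x).le
    have h4 : ∑ m ∈ Finset.range (n + 1), c m * w m ≤ ∑ m ∈ Finset.range M, c m * w m := by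
      refine Finset.sum_le_sum_of_subset_of_nonneg ?_ fun x _ _ => mul_nonneg (hc x) (hw x).le
      have := Finset.mem_range.1 (hs hns)
      intro x hx
      rw [Finset.mem_range] at hx ⊢
      omega
    have h5 : 0 ≤ ∑ x ∈ Finset.Ico 0 (n + 1), w x := Finset.sum_nonneg fun x _ => (hw x).le
    have hn1 : (0 : ℝ) < n + 1 := by positivity
    have h6 : (n + 1 : ℝ) * (τ * ∑ x ∈ s, w x) ≤
        (n + 1) * (A * ∑ m ∈ Finset.range M, c m * w m) := by
      calc (n + 1 : ℝ) * (τ * ∑ x ∈ s, w x) ≤ (τ * (n + 1)) * ∑ x ∈ Finset.Ico 0 (n + 1), w x := by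
            rw [← mul_assoc, mul_comm (n + 1 : ℝ)]
            gcongr
        _ ≤ (∑ m ∈ Finset.range (n + 1), c m) * ∑ x ∈ Finset.Ico 0 (n + 1), w x := by
            gcongr
        _ ≤ A * (n + 1) * ∑ m ∈ Finset.range (n + 1), c m * w m := h2
        _ ≤ A * (n + 1) * ∑ m ∈ Finset.range M, c m * w m := by gcongr
        _ = _ := by ring
    exact le_of_mul_le_mul_left h6 hn1

theorem dyadic_eq_range {N j : ℕ} (h : dyadic N j ⊆ Finset.range (2 ^ N)) :
    dyadic N j = Finset.range (2 ^ N) :=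
  Finset.eq_of_subset_of_card_le h (by rw [card_dyadic, Finset.card_range])

/-- The Calderón-Zygmund decomposition at height `t`. -/
theorem exists_calderonZygmund (𝕜 : Type*) {E : Type*} [RCLike 𝕜]
    [NormedAddCommGroup E] [NormedSpace 𝕜 E] (f : ℕ → E) {t : ℝ} {N : ℕ}
    (htop : ∑ n ∈ Finset.range (2 ^ N), ‖f n‖ ≤ t * 2 ^ N) :
    ∃ (𝓜 : Finset (ℕ × ℕ)) (g : ℕ → E),
      (𝓜 : Set (ℕ × ℕ)).PairwiseDisjoint (fun P => dyadic P.1 P.2) ∧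
      (∀ P ∈ 𝓜, dyadic P.1 P.2 ⊆ Finset.range (2 ^ N) ∧
        t * 2 ^ P.1 < ∑ n ∈ dyadic P.1 P.2, ‖f n‖ ∧
        ∑ n ∈ dyadic P.1 P.2, (f n - g n) = 0 ∧
        ∀ n ∈ dyadic P.1 P.2, ‖g n‖ ≤ 2 * t ∧
          2 ^ P.1 * ‖g n‖ ≤ ∑ n ∈ dyadic P.1 P.2, ‖f n‖) ∧
      ∀ n < 2 ^ N, n ∉ 𝓜.biUnion (fun P => dyadic P.1 P.2) → g n = f n ∧ ‖f n‖ ≤ t := by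
  classical
  obtain ⟨𝓜, h1, h2, h3⟩ := exists_maximal_dyadic N
    (fun k j => t * 2 ^ k < ∑ y ∈ dyadic k j, ‖f y‖)
  set avg : ℕ × ℕ → E := fun P => ((2 : 𝕜) ^ P.1)⁻¹ • ∑ m ∈ dyadic P.1 P.2, f m with havg
  set g : ℕ → E := fun n => if h : ∃ P ∈ 𝓜, n ∈ dyadic P.1 P.2 then avg h.choose else f n with hg
  have hgP : ∀ P ∈ 𝓜, ∀ n ∈ dyadic P.1 P.2, g n = avg P := by
    intro P hP n hn
    have hex : ∃ P ∈ 𝓜, n ∈ dyadic P.1 P.2 := ⟨P, hP, hn⟩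
    have hch := hex.choose_spec
    rw [hg]
    dsimp only
    rw [dif_pos hex]
    congr 1
    by_contra hne
    exact Finset.disjoint_left.1 (h2 hch.1 hP hne) hch.2 hn
  have hnavg : ∀ P, 2 ^ P.1 * ‖avg P‖ ≤ ∑ n ∈ dyadic P.1 P.2, ‖f n‖ := by
    intro P
    rw [havg, norm_smul, norm_inv, norm_pow, RCLike.norm_ofNat, mul_inv_cancel_left₀ (by positivity)]
    exact norm_sum_le _ _
  refine ⟨𝓜, g, h2, fun P hP => ⟨(h1 P hP).2.2.1, (h1 P hP).2.1, ?_, ?_⟩, ?_⟩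
  · rw [Finset.sum_sub_distrib, Finset.sum_congr rfl (hgP P hP), Finset.sum_const, card_dyadic,
      ← Nat.cast_smul_eq_nsmul 𝕜, havg, smul_smul]
    push_cast
    rw [mul_inv_cancel₀ (pow_ne_zero _ two_ne_zero), one_smul, sub_self]
  · intro n hn
    rw [hgP P hP n hn]
    refine ⟨?_, hnavg P⟩
    obtain ⟨hPN, hB, hsub, hmax⟩ := h1 P hP
    -- The hypothesis on the whole window excludes level N, so the parent of P is a competitor that
    -- fails the stopping condition. Passing from P to its parent costs the factor 2 in the height
    -- of g.
    have hlt : P.1 < N := by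
      refine lt_of_le_of_ne hPN fun heq => ?_
      rw [heq] at hsub hB
      rw [dyadic_eq_range hsub] at hB
      linarith
    have h4 := hmax n hn (P.1 + 1) (by omega) (by omega)
    rw [not_lt] at h4
    have h5 : ∑ y ∈ dyadic P.1 P.2, ‖f y‖ ≤ ∑ y ∈ dyadic (P.1 + 1) (n / 2 ^ (P.1 + 1)), ‖f y‖ := by
      refine Finset.sum_le_sum_of_subset_of_nonneg ?_ fun _ _ _ => norm_nonneg _
      rw [← mem_dyadic.1 hn]
      exact dyadic_subset_of_mem (by omega)
    have h6 := hnavg P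
    have h9 : t * 2 ^ (P.1 + 1) = 2 ^ P.1 * (2 * t) := by ring
    have h7 : (0 : ℝ) < 2 ^ P.1 := by positivity
    have h8 : 2 ^ P.1 * ‖avg P‖ ≤ 2 ^ P.1 * (2 * t) := by linarith
    exact le_of_mul_le_mul_left h8 h7
  · intro n hn hnU
    have hnP : ¬ ∃ P ∈ 𝓜, n ∈ dyadic P.1 P.2 := by
      rintro ⟨P, hP, hnP⟩
      exact hnU (Finset.mem_biUnion.2 ⟨P, hP, hnP⟩)
    constructor
    · rw [hg]
      dsimp only
      rw [dif_neg hnP]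
    · by_contra hc
      -- Intervals of level 0 are single points, so the decomposition bounds f at every point off
      -- the stopping intervals, without any differentiation theorem.
      obtain ⟨P, hP, hnP', -⟩ := h3 n hn 0 (Nat.zero_le _) (by
        rw [show dyadic 0 (n / 2 ^ 0) = {n} by ext; simp [mem_dyadic],
          Finset.sum_singleton, pow_zero, mul_one]
        exact not_le.1 hc)
      exact hnP ⟨P, hP, hnP'⟩

theorem A1Bound.sum_triple_le {w : ℕ → ℝ} (hw : ∀ n, 0 < w n) {A : ℝ} (hA : A1Bound w A)
    {k j x : ℕ} (hx : x ∈ triple k j) : ∑ y ∈ triple k j, w y ≤ 2 ^ k * (3 * A * w x) := by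
  have h1 := hA.one_le hw
  have h2 : ((triple k j).card : ℝ) ≤ 3 * 2 ^ k := by exact_mod_cast card_triple_le k j
  have h3 := hw x
  calc ∑ y ∈ triple k j, w y ≤ A * (triple k j).card * w x := hA _ _ x hx
    _ ≤ A * (3 * 2 ^ k) * w x := by gcongr
    _ = _ := by ring

/-- The `A_1` bound for the adjoint of the majorant of the good part of the kernel. -/
theorem A1Bound.sum_majorant_le {w : ℕ → ℝ} (hw : ∀ n, 0 < w n) {A : ℝ} (hA : A1Bound w A)
    {N k m : ℕ} (hm : m < 2 ^ N) {s : Finset ℕ} (hs : s ⊆ Finset.range (2 ^ N))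
    (hsk : ∀ n ∈ s, n ∉ triple k (m / 2 ^ k)) :
    ∑ n ∈ s, (2 ^ k / |(n : ℝ) - m| ^ 2 + if n ≤ m then 1 / ((m : ℝ) + 1) else 0) * w n ≤
      13 * A * w m := by
  have h1 := hA.one_le hw
  have hwm := hw m
  simp only [add_mul]
  rw [Finset.sum_add_distrib]
  -- The constant 13 is 4 · 3 from the Poisson part, taken with averages of w at most 3 A w(m), plus
  -- 1 from the dual Hardy part.
  have e1 := sum_poisson_le hm (φ := w) (fun n => (hw n).le) (Λ := 3 * A * w m) (by positivity)
    (k := k) (fun i _ => hA.sum_triple_le hw (dyadic_subset_triple _ _ (mem_dyadic_self i m))) hs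
    (fun n hn => two_pow_le_abs_of_notMem_triple (hsk n hn))
  have e2 : ∑ n ∈ s, (if n ≤ m then 1 / ((m : ℝ) + 1) else 0) * w n ≤ A * w m := by
    have h2 := hA 0 (m + 1) m (by simp)
    rw [Nat.card_Ico, Nat.sub_zero] at h2
    push_cast at h2
    have h3 : (0 : ℝ) < m + 1 := by positivity
    calc ∑ n ∈ s, (if n ≤ m then 1 / ((m : ℝ) + 1) else 0) * w n
        = ∑ n ∈ s with n ≤ m, 1 / ((m : ℝ) + 1) * w n := by
          rw [Finset.sum_filter]
          refine Finset.sum_congr rfl fun n _ => ?_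
          split_ifs <;> simp
      _ ≤ ∑ n ∈ Finset.Ico 0 (m + 1), 1 / ((m : ℝ) + 1) * w n := by
          refine Finset.sum_le_sum_of_subset_of_nonneg ?_ fun n _ _ => ?_
          · intro n hn
            rw [Finset.mem_Ico]
            exact ⟨Nat.zero_le _, Nat.lt_succ_of_le (Finset.mem_filter.1 hn).2⟩
          · have := hw n
            positivity
      _ = 1 / ((m : ℝ) + 1) * ∑ n ∈ Finset.Ico 0 (m + 1), w n := by rw [Finset.mul_sum]
      _ ≤ 1 / ((m : ℝ) + 1) * (A * (m + 1) * w m) := by gcongr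
      _ = A * w m := by field_simp
  linarith

/-! ### Weak type (1,1) by Calderón-Zygmund decomposition. -/

/-- The operator with matrix `K`, applied to the restriction of `f` to `S`. -/
noncomputable def matApply (K : ℕ → ℕ → E →L[𝕜] F) (S : Finset ℕ) (f : ℕ → E) (n : ℕ) : F :=
  ∑ m ∈ S, K n m (f m)

theorem matApply_add (K : ℕ → ℕ → E →L[𝕜] F) (S : Finset ℕ) (f g : ℕ → E) (n : ℕ) :
    matApply K S (f + g) n = matApply K S f n + matApply K S g n := by
  simp [matApply, Finset.sum_add_distrib]

/-- Cancellation of `b` on each interval replaces the kernel by its oscillation. The Hardy part of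
the majorant is split at m = n because its halves behave differently: for n ≤ m it can be summed in
n against an A_1 weight, whereas for m ≤ n only a weak type bound holds, so that half is kept as a
Hardy average. -/
theorem norm_matApply_bad_le {K : ℕ → ℕ → E →L[𝕜] F} {C : ℝ} (hC : 0 ≤ C)
    (hK : HasOscBound K C) {𝓜 : Finset (ℕ × ℕ)} {S : Finset ℕ} {b : ℕ → E}
    (hd : (𝓜 : Set (ℕ × ℕ)).PairwiseDisjoint (fun P => dyadic P.1 P.2))
    (hS : ∀ P ∈ 𝓜, dyadic P.1 P.2 ⊆ S) (hb : ∀ P ∈ 𝓜, ∑ n ∈ dyadic P.1 P.2, b n = 0)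
    (hb0 : ∀ n ∈ S, n ∉ 𝓜.biUnion (fun P => dyadic P.1 P.2) → b n = 0) {n : ℕ}
    (hn : ∀ P ∈ 𝓜, n ∉ triple P.1 P.2) :
    ‖matApply K S b n‖ ≤
      C * (∑ P ∈ 𝓜, ∑ m ∈ dyadic P.1 P.2,
          (2 ^ P.1 / |(n : ℝ) - m| ^ 2 + if n ≤ m then 1 / ((m : ℝ) + 1) else 0) * ‖b m‖ +
        ∑ m ∈ Finset.range (n + 1), ‖b m‖ / ((n : ℝ) + 1)) := by
  classical
  have hsub : 𝓜.biUnion (fun P => dyadic P.1 P.2) ⊆ S := Finset.biUnion_subset.2 hS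
  have e1 : matApply K S b n = ∑ P ∈ 𝓜, ∑ m ∈ dyadic P.1 P.2, K n m (b m) := by
    rw [matApply, ← Finset.sum_subset hsub, Finset.sum_biUnion hd]
    intro m hm hmU
    rw [hb0 m hm hmU, map_zero]
  have e2 : ∀ P ∈ 𝓜, ‖∑ m ∈ dyadic P.1 P.2, K n m (b m)‖ ≤
      ∑ m ∈ dyadic P.1 P.2, C * oscMajorant P.1 m n * ‖b m‖ := by
    intro P hP
    obtain ⟨c, hc⟩ := dyadic_nonempty P.1 P.2
    -- The reference point c is fixed but the majorant is centred at the variable m, so the later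
    -- sum over n is a sum around m.
    have : ∑ m ∈ dyadic P.1 P.2, K n m (b m) = -∑ m ∈ dyadic P.1 P.2, (K n c - K n m) (b m) := by
      simp only [sub_apply]
      rw [Finset.sum_sub_distrib, ← map_sum, hb P hP, map_zero, zero_sub, neg_neg]
    rw [this, norm_neg]
    refine (norm_sum_le _ _).trans (Finset.sum_le_sum fun m hm => ?_)
    refine (ContinuousLinearMap.le_opNorm _ _).trans ?_
    gcongr
    have hm' := mem_dyadic.1 hm
    exact hK.right ((mem_dyadic.1 hc).trans hm'.symm) (hm' ▸ hn P hP)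
  have e3 : ∀ P : ℕ × ℕ, ∀ m, C * oscMajorant P.1 m n * ‖b m‖ ≤
      C * ((2 ^ P.1 / |(n : ℝ) - m| ^ 2 + if n ≤ m then 1 / ((m : ℝ) + 1) else 0) * ‖b m‖) +
      C * (if m ≤ n then ‖b m‖ / ((n : ℝ) + 1) else 0) := by
    intro P m
    rw [← mul_add, mul_assoc]
    refine mul_le_mul_of_nonneg_left ?_ hC
    rw [oscMajorant, add_mul, add_mul, add_assoc]
    refine add_le_add le_rfl ?_
    have h0 := norm_nonneg (b m)
    rcases le_total n m with h | h
    · rw [if_pos h, max_eq_left (by exact_mod_cast h)]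
      have : 0 ≤ (if m ≤ n then ‖b m‖ / ((n : ℝ) + 1) else 0) := by split_ifs <;> positivity
      linarith
    · rw [if_pos h, max_eq_right (by exact_mod_cast h), one_div_mul_eq_div]
      have : 0 ≤ (if n ≤ m then 1 / ((m : ℝ) + 1) else 0) * ‖b m‖ := by
        split_ifs
        · positivity
        · simp
      linarith
  rw [e1]
  calc ‖∑ P ∈ 𝓜, ∑ m ∈ dyadic P.1 P.2, K n m (b m)‖
      ≤ ∑ P ∈ 𝓜, ∑ m ∈ dyadic P.1 P.2, C * oscMajorant P.1 m n * ‖b m‖ :=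
        (norm_sum_le _ _).trans (Finset.sum_le_sum e2)
    _ ≤ ∑ P ∈ 𝓜, ∑ m ∈ dyadic P.1 P.2,
        (C * ((2 ^ P.1 / |(n : ℝ) - m| ^ 2 + if n ≤ m then 1 / ((m : ℝ) + 1) else 0) * ‖b m‖) +
          C * (if m ≤ n then ‖b m‖ / ((n : ℝ) + 1) else 0)) :=
        Finset.sum_le_sum fun P _ => Finset.sum_le_sum fun m _ => e3 P m
    _ = C * (∑ P ∈ 𝓜, ∑ m ∈ dyadic P.1 P.2,
          (2 ^ P.1 / |(n : ℝ) - m| ^ 2 + if n ≤ m then 1 / ((m : ℝ) + 1) else 0) * ‖b m‖ +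
        ∑ m ∈ 𝓜.biUnion (fun P => dyadic P.1 P.2),
          if m ≤ n then ‖b m‖ / ((n : ℝ) + 1) else 0) := by
        rw [Finset.sum_biUnion hd, mul_add, Finset.mul_sum, Finset.mul_sum,
          ← Finset.sum_add_distrib]
        refine Finset.sum_congr rfl fun P _ => ?_
        rw [Finset.sum_add_distrib, Finset.mul_sum, Finset.mul_sum]
    _ ≤ _ := by
        refine mul_le_mul_of_nonneg_left (add_le_add le_rfl ?_) hC
        rw [← Finset.sum_filter]
        refine Finset.sum_le_sum_of_subset_of_nonneg ?_ fun _ _ _ => by positivity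
        intro m hm
        rw [Finset.mem_range]
        exact Nat.lt_succ_of_le (Finset.mem_filter.1 hm).2

/-- Weak type `(1,1)` for an `A_1` weight, from a weighted strong type bound. -/
theorem weak_type_window {K : ℕ → ℕ → E →L[𝕜] F} {C : ℝ} (hC : 0 < C) (hK : HasOscBound K C)
    {w : ℕ → ℝ} (hw : ∀ n, 0 < w n) {A : ℝ} (hA : A1Bound w A) {q B : ℝ} (hq : 1 < q)
    (hB : 0 ≤ B)
    (hL : ∀ (N : ℕ) (f : ℕ → E),
      ∑ n ∈ Finset.range (2 ^ N), ‖matApply K (Finset.range (2 ^ N)) f n‖ ^ q * w n ≤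
        B * ∑ m ∈ Finset.range (2 ^ N), ‖f m‖ ^ q * w m) :
    ∃ C' : ℝ, 0 < C' ∧ ∀ (N : ℕ) (f : ℕ → E) (t : ℝ), 0 < t →
      t * ∑ n ∈ Finset.range (2 ^ N) with t < ‖matApply K (Finset.range (2 ^ N)) f n‖, w n ≤
        C' * ∑ m ∈ Finset.range (2 ^ N), ‖f m‖ * w m := by
  classical
  have hA1 := hA.one_le hw
  -- The four terms pay for the triples of the stopping intervals, the good part, the Poisson and
  -- dual Hardy part of the bad function, and its Hardy part.
  refine ⟨3 * A + B * 2 ^ (2 * q) * (1 + A) + 4 * C * (13 * A * (2 + A)) +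
    4 * C * (A * (2 + A)), by positivity, fun N f t ht => ?_⟩
  set R := Finset.range (2 ^ N) with hR
  set Z := ∑ m ∈ R, ‖f m‖ * w m with hZ
  have hwn : ∀ n, 0 ≤ w n := fun n => (hw n).le
  have hZ0 : 0 ≤ Z := Finset.sum_nonneg fun n _ => mul_nonneg (norm_nonneg _) (hwn n)
  have hc2 : 0 ≤ B * 2 ^ (2 * q) * (1 + A) * Z := by positivity
  have hc3 : 0 ≤ 4 * C * (13 * A * (2 + A)) * Z := by positivity
  have hc4 : 0 ≤ 4 * C * (A * (2 + A)) * Z := by positivity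
  have hc1 : 0 ≤ A * Z := by positivity
  by_cases htop : ∑ n ∈ R, ‖f n‖ ≤ t * 2 ^ N
  swap
  -- If the mean over the whole window exceeds t, the A_1 condition on the window already bounds t
  -- times the total weight.
  · have h1 := hA.sum_mul_sum_le (a := 0) (b := 2 ^ N) (s := R) (by rw [hR, Finset.range_eq_Ico])
      (c := fun n => ‖f n‖) (fun n => norm_nonneg _)
    rw [← Finset.range_eq_Ico, Finset.card_range, ← hR, ← hZ] at h1
    push_cast at h1
    have h2 : ∑ n ∈ R with t < ‖matApply K R f n‖, w n ≤ ∑ n ∈ R, w n :=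
      Finset.sum_le_sum_of_subset_of_nonneg (Finset.filter_subset _ _) fun n _ _ => hwn n
    have h3 : 0 ≤ ∑ n ∈ R, w n := Finset.sum_nonneg fun n _ => hwn n
    have h4 : (2 : ℝ) ^ N * (t * ∑ n ∈ R, w n) ≤ 2 ^ N * (A * Z) := by
      calc (2 : ℝ) ^ N * (t * ∑ n ∈ R, w n) = (t * 2 ^ N) * ∑ n ∈ R, w n := by ring
        _ ≤ (∑ n ∈ R, ‖f n‖) * ∑ n ∈ R, w n := by gcongr; exact (not_le.1 htop).le
        _ ≤ A * 2 ^ N * Z := h1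
        _ = _ := by ring
    have h5 := le_of_mul_le_mul_left h4 (by positivity)
    have h6 : t * ∑ n ∈ R with t < ‖matApply K R f n‖, w n ≤ t * ∑ n ∈ R, w n := by gcongr
    nlinarith
  obtain ⟨𝓜, g, hd, hP, hoff⟩ := exists_calderonZygmund 𝕜 f htop
  set U := 𝓜.biUnion (fun P => dyadic P.1 P.2) with hU
  set V := 𝓜.biUnion (fun P => triple P.1 P.2) with hV
  set b : ℕ → E := fun n => f n - g n with hb
  have hUR : U ⊆ R := Finset.biUnion_subset.2 fun P h => (hP P h).1
  -- weighted norm of the good and bad parts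
  have hgU : ∑ n ∈ U, ‖g n‖ * w n ≤ A * ∑ n ∈ U, ‖f n‖ * w n := by
    rw [hU, Finset.sum_biUnion hd, Finset.sum_biUnion hd, Finset.mul_sum]
    refine Finset.sum_le_sum fun P h => ?_
    obtain ⟨-, -, -, hg⟩ := hP P h
    have h1 := hA.sum_mul_sum_le (a := P.2 * 2 ^ P.1) (b := (P.2 + 1) * 2 ^ P.1)
      (s := dyadic P.1 P.2) (by rfl) (c := fun n => ‖f n‖) (fun n => norm_nonneg _)
    rw [← dyadic, card_dyadic] at h1
    push_cast at h1
    have h2 : (2 : ℝ) ^ P.1 * ∑ n ∈ dyadic P.1 P.2, ‖g n‖ * w n ≤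
        2 ^ P.1 * (A * ∑ n ∈ dyadic P.1 P.2, ‖f n‖ * w n) := by
      calc (2 : ℝ) ^ P.1 * ∑ n ∈ dyadic P.1 P.2, ‖g n‖ * w n
          = ∑ n ∈ dyadic P.1 P.2, (2 ^ P.1 * ‖g n‖) * w n := by
            rw [Finset.mul_sum]
            exact Finset.sum_congr rfl fun n _ => by ring
        _ ≤ ∑ n ∈ dyadic P.1 P.2, (∑ m ∈ dyadic P.1 P.2, ‖f m‖) * w n :=
            Finset.sum_le_sum fun n hn => mul_le_mul_of_nonneg_right (hg n hn).2 (hwn n)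
        _ = (∑ m ∈ dyadic P.1 P.2, ‖f m‖) * ∑ n ∈ dyadic P.1 P.2, w n := by
            rw [Finset.mul_sum]
        _ ≤ _ := h1
        _ = _ := by ring
    exact le_of_mul_le_mul_left h2 (by positivity)
  have hUZ : ∑ n ∈ U, ‖f n‖ * w n ≤ Z := Finset.sum_le_sum_of_subset_of_nonneg hUR
    fun n _ _ => mul_nonneg (norm_nonneg _) (hwn n)
  have hgR : ∑ n ∈ R, ‖g n‖ * w n ≤ (1 + A) * Z := by
    rw [← Finset.sum_sdiff hUR]
    have h1 : ∑ n ∈ R \ U, ‖g n‖ * w n ≤ Z := by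
      calc ∑ n ∈ R \ U, ‖g n‖ * w n = ∑ n ∈ R \ U, ‖f n‖ * w n := by
            refine Finset.sum_congr rfl fun n hn => ?_
            rw [Finset.mem_sdiff, Finset.mem_range] at hn
            rw [(hoff n hn.1 hn.2).1]
        _ ≤ Z := Finset.sum_le_sum_of_subset_of_nonneg Finset.sdiff_subset
            fun n _ _ => mul_nonneg (norm_nonneg _) (hwn n)
    nlinarith
  have hbR : ∑ n ∈ R, ‖b n‖ * w n ≤ (2 + A) * Z := by
    calc ∑ n ∈ R, ‖b n‖ * w n ≤ ∑ n ∈ R, (‖f n‖ * w n + ‖g n‖ * w n) := by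
          refine Finset.sum_le_sum fun n _ => ?_
          rw [← add_mul]
          exact mul_le_mul_of_nonneg_right (norm_sub_le _ _) (hwn n)
      _ = Z + ∑ n ∈ R, ‖g n‖ * w n := Finset.sum_add_distrib
      _ ≤ _ := by linarith
  have hg2t : ∀ n ∈ R, ‖g n‖ ≤ 2 * t := by
    intro n hn
    by_cases hnU : n ∈ U
    · obtain ⟨P, h, hnP⟩ := Finset.mem_biUnion.1 hnU
      exact ((hP P h).2.2.2 n hnP).1
    · obtain ⟨h1, h2⟩ := hoff n (Finset.mem_range.1 hn) hnU
      rw [h1]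
      linarith
  -- the exceptional set
  have hVw : t * ∑ n ∈ V, w n ≤ 3 * A * Z := by
    calc t * ∑ n ∈ V, w n ≤ t * ∑ P ∈ 𝓜, ∑ n ∈ triple P.1 P.2, w n := by
          gcongr
          exact sum_biUnion_le 𝓜 _ hwn
      _ = ∑ P ∈ 𝓜, t * ∑ n ∈ triple P.1 P.2, w n := Finset.mul_sum _ _ _
      _ ≤ ∑ P ∈ 𝓜, 3 * A * ∑ n ∈ dyadic P.1 P.2, ‖f n‖ * w n := by
          refine Finset.sum_le_sum fun P h => ?_
          obtain ⟨-, h1, -, -⟩ := hP P h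
          have h0 : 0 ≤ ∑ n ∈ triple P.1 P.2, w n := Finset.sum_nonneg fun n _ => hwn n
          have h2 : (2 : ℝ) ^ P.1 * (t * ∑ n ∈ triple P.1 P.2, w n) ≤
              2 ^ P.1 * (3 * A * ∑ n ∈ dyadic P.1 P.2, ‖f n‖ * w n) := by
            calc (2 : ℝ) ^ P.1 * (t * ∑ n ∈ triple P.1 P.2, w n)
                = (t * 2 ^ P.1) * ∑ n ∈ triple P.1 P.2, w n := by ring
              _ ≤ (∑ n ∈ dyadic P.1 P.2, ‖f n‖) * ∑ n ∈ triple P.1 P.2, w n := by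
                  gcongr
              _ ≤ ∑ n ∈ dyadic P.1 P.2, 2 ^ P.1 * (3 * A * (‖f n‖ * w n)) := by
                  rw [Finset.sum_mul]
                  refine Finset.sum_le_sum fun n hn => ?_
                  calc ‖f n‖ * ∑ n ∈ triple P.1 P.2, w n ≤ ‖f n‖ * (2 ^ P.1 * (3 * A * w n)) := by
                        gcongr
                        exact hA.sum_triple_le hw (dyadic_subset_triple _ _ hn)
                    _ = _ := by ring
              _ = _ := by rw [← Finset.mul_sum, ← Finset.mul_sum]
          exact le_of_mul_le_mul_left h2 (by positivity)
      _ = 3 * A * ∑ n ∈ U, ‖f n‖ * w n := by rw [← Finset.mul_sum, hU, Finset.sum_biUnion hd]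
      _ ≤ 3 * A * Z := by gcongr
  -- the good part
  have hgood : t * ∑ n ∈ R with t / 2 < ‖matApply K R g n‖, w n ≤
      B * 2 ^ (2 * q) * (1 + A) * Z := by
    have h1 : (t / 2) ^ q * ∑ n ∈ R with t / 2 < ‖matApply K R g n‖, w n ≤
        ∑ n ∈ R, ‖matApply K R g n‖ ^ q * w n := by
      have e : {n ∈ R | t / 2 < ‖matApply K R g n‖} =
          {n ∈ R | (t / 2) ^ q < ‖matApply K R g n‖ ^ q} := Finset.filter_congr fun n _ =>
        (Real.rpow_lt_rpow_iff (by positivity) (norm_nonneg _) (by linarith)).symm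
      rw [e]
      exact chebyshev_sum hwn (X := fun n => ‖matApply K R g n‖ ^ q)
        (fun n => by positivity) ((t / 2) ^ q)
    -- The bound 2t on g lowers the power q to 1, so the weighted ℓ^1 norm suffices.
    have h2 : ∑ m ∈ R, ‖g m‖ ^ q * w m ≤ (2 * t) ^ (q - 1) * ((1 + A) * Z) := by
      calc ∑ m ∈ R, ‖g m‖ ^ q * w m ≤ ∑ m ∈ R, (2 * t) ^ (q - 1) * (‖g m‖ * w m) := by
            refine Finset.sum_le_sum fun m hm => ?_
            have : ‖g m‖ ^ q = ‖g m‖ ^ (q - 1) * ‖g m‖ := by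
              rcases (norm_nonneg (g m)).eq_or_lt with h0 | h0
              · rw [← h0, Real.zero_rpow (by linarith), mul_zero]
              · rw [← Real.rpow_add_one h0.ne', sub_add_cancel]
            rw [this, mul_assoc]
            refine mul_le_mul_of_nonneg_right ?_ (mul_nonneg (norm_nonneg _) (hwn m))
            exact Real.rpow_le_rpow (norm_nonneg _) (hg2t m hm) (by linarith)
        _ ≤ _ := by
            rw [← Finset.mul_sum]
            gcongr
    have h3 : (t / 2) ^ q * ∑ n ∈ R with t / 2 < ‖matApply K R g n‖, w n ≤
        B * ((2 * t) ^ (q - 1) * ((1 + A) * Z)) :=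
      h1.trans ((hL N g).trans (mul_le_mul_of_nonneg_left h2 hB))
    have h4 : (2 * t) ^ (q - 1) = (t / 2) ^ q * (2 ^ (2 * q) / (2 * t)) := by
      rw [Real.rpow_sub_one (by positivity), Real.mul_rpow zero_le_two ht.le,
        Real.div_rpow ht.le zero_le_two, two_mul q, Real.rpow_add two_pos]
      have : (2 : ℝ) ^ q ≠ 0 := by positivity
      field_simp
    rw [h4] at h3
    have h5 : (t / 2) ^ q * (t * ∑ n ∈ R with t / 2 < ‖matApply K R g n‖, w n) ≤
        (t / 2) ^ q * (B * 2 ^ (2 * q) * (1 + A) * Z / 2) := by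
      calc (t / 2) ^ q * (t * ∑ n ∈ R with t / 2 < ‖matApply K R g n‖, w n)
          = t * ((t / 2) ^ q * ∑ n ∈ R with t / 2 < ‖matApply K R g n‖, w n) := by ring
        _ ≤ t * (B * ((t / 2) ^ q * (2 ^ (2 * q) / (2 * t)) * ((1 + A) * Z))) := by gcongr
        _ = _ := by field_simp
    have h6 := le_of_mul_le_mul_left h5 (by positivity)
    linarith
  -- the bad part
  set X : ℕ → ℝ := fun n => ∑ P ∈ 𝓜, ∑ m ∈ dyadic P.1 P.2,
    (2 ^ P.1 / |(n : ℝ) - m| ^ 2 + if n ≤ m then 1 / ((m : ℝ) + 1) else 0) * ‖b m‖ with hX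
  set Y : ℕ → ℝ := fun n => ∑ m ∈ Finset.range (n + 1), ‖b m‖ / ((n : ℝ) + 1) with hY
  have hκ0 : ∀ (k n m : ℕ),
      0 ≤ (2 ^ k / |(n : ℝ) - m| ^ 2 + if n ≤ m then 1 / ((m : ℝ) + 1) else 0) := by
    intro k n m
    split_ifs <;> positivity
  have hX0 : ∀ n, 0 ≤ X n := fun n => Finset.sum_nonneg fun P _ => Finset.sum_nonneg fun m _ =>
    mul_nonneg (hκ0 _ _ _) (norm_nonneg _)
  have hXw : t / (4 * C) * ∑ n ∈ R \ V with t / (4 * C) < X n, w n ≤ 13 * A * ((2 + A) * Z) := by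
    refine (chebyshev_sum hwn hX0 _).trans ?_
    calc ∑ n ∈ R \ V, X n * w n
        = ∑ P ∈ 𝓜, ∑ m ∈ dyadic P.1 P.2, ‖b m‖ * ∑ n ∈ R \ V,
          (2 ^ P.1 / |(n : ℝ) - m| ^ 2 + if n ≤ m then 1 / ((m : ℝ) + 1) else 0) * w n := by
          simp only [hX, Finset.sum_mul]
          rw [Finset.sum_comm]
          refine Finset.sum_congr rfl fun P _ => ?_
          rw [Finset.sum_comm]
          refine Finset.sum_congr rfl fun m _ => ?_
          rw [Finset.mul_sum]
          exact Finset.sum_congr rfl fun n _ => by ring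
      _ ≤ ∑ P ∈ 𝓜, ∑ m ∈ dyadic P.1 P.2, ‖b m‖ * (13 * A * w m) := by
          refine Finset.sum_le_sum fun P h => Finset.sum_le_sum fun m hm => ?_
          refine mul_le_mul_of_nonneg_left ?_ (norm_nonneg _)
          refine hA.sum_majorant_le hw (Finset.mem_range.1 ((hP P h).1 hm)) Finset.sdiff_subset ?_
          intro n hn hn'
          rw [mem_dyadic.1 hm] at hn'
          exact (Finset.mem_sdiff.1 hn).2 (Finset.mem_biUnion.2 ⟨P, h, hn'⟩)
      _ = 13 * A * ∑ m ∈ U, ‖b m‖ * w m := by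
          rw [hU, Finset.sum_biUnion hd, Finset.mul_sum]
          refine Finset.sum_congr rfl fun P _ => ?_
          rw [Finset.mul_sum]
          exact Finset.sum_congr rfl fun n _ => by ring
      _ ≤ 13 * A * ((2 + A) * Z) := by
          gcongr
          exact (Finset.sum_le_sum_of_subset_of_nonneg hUR
            fun n _ _ => mul_nonneg (norm_nonneg _) (hwn n)).trans hbR
  have hYw : t / (4 * C) * ∑ n ∈ R with t / (4 * C) < Y n, w n ≤ A * ((2 + A) * Z) := by
    refine (weak_hardy hw hA (M := 2 ^ N) (c := fun m => ‖b m‖) (fun m => norm_nonneg _)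
      (by positivity) (Finset.filter_subset _ _)
      (fun n hn => (Finset.mem_filter.1 hn).2)).trans ?_
    gcongr
  -- Off these four sets the bad part is at most C (t/(4C) + t/(4C)) = t/2 and the good part at most
  -- t/2.
  have hcover : {n ∈ R | t < ‖matApply K R f n‖} ⊆
      V ∪ {n ∈ R | t / 2 < ‖matApply K R g n‖} ∪ {n ∈ R \ V | t / (4 * C) < X n} ∪
        {n ∈ R | t / (4 * C) < Y n} := by
    intro n hn
    obtain ⟨hnR, hnt⟩ := Finset.mem_filter.1 hn
    by_contra hc
    simp only [Finset.mem_union, Finset.mem_filter, Finset.mem_sdiff, not_or, not_and, not_lt]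
      at hc
    obtain ⟨⟨⟨hnV, h1⟩, h2⟩, h3⟩ := hc
    have h1 := h1 hnR
    have h2 := h2 ⟨hnR, hnV⟩
    have h3 := h3 hnR
    have h4 := norm_matApply_bad_le hC.le hK (S := R) (b := b) hd (fun P h => (hP P h).1)
      (fun P h => (hP P h).2.2.1)
      (fun n hn hnU => by rw [hb]; dsimp only; rw [(hoff n (Finset.mem_range.1 hn) hnU).1, sub_self])
      (n := n) (fun P h hnP => hnV (Finset.mem_biUnion.2 ⟨P, h, hnP⟩))
    have h5 : f = g + b := by
      ext n
      simp [hb]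
    rw [h5, matApply_add] at hnt
    have h6 := norm_add_le (matApply K R g n) (matApply K R b n)
    have h7 : C * (X n + Y n) ≤ C * (t / (4 * C) + t / (4 * C)) := by gcongr
    have h8 : C * (t / (4 * C) + t / (4 * C)) = t / 2 := by field_simp; norm_num
    have h9 : ‖matApply K R b n‖ ≤ C * (X n + Y n) := h4
    linarith
  have hunion : ∀ s s' : Finset ℕ, ∑ n ∈ s ∪ s', w n ≤ ∑ n ∈ s, w n + ∑ n ∈ s', w n := by
    intro s s'
    have h1 := Finset.sum_union_inter (s₁ := s) (s₂ := s') (f := w)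
    have h2 : 0 ≤ ∑ n ∈ s ∩ s', w n := Finset.sum_nonneg fun n _ => hwn n
    linarith
  have hfin := (Finset.sum_le_sum_of_subset_of_nonneg hcover fun n _ _ => hwn n).trans
    ((hunion _ _).trans (add_le_add ((hunion _ _).trans (add_le_add (hunion _ _) le_rfl)) le_rfl))
  have hfin' := mul_le_mul_of_nonneg_left hfin ht.le
  have hX' : t * ∑ n ∈ R \ V with t / (4 * C) < X n, w n ≤ 4 * C * (13 * A * ((2 + A) * Z)) := by
    have := mul_le_mul_of_nonneg_left hXw (by positivity : 0 ≤ 4 * C)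
    rwa [← mul_assoc, mul_div_cancel₀ _ (by positivity)] at this
  have hY' : t * ∑ n ∈ R with t / (4 * C) < Y n, w n ≤ 4 * C * (A * ((2 + A) * Z)) := by
    have := mul_le_mul_of_nonneg_left hYw (by positivity : 0 ≤ 4 * C)
    rwa [← mul_assoc, mul_div_cancel₀ _ (by positivity)] at this
  linarith

theorem matApply_indicator (K : ℕ → ℕ → E →L[𝕜] F) {S R : Finset ℕ} (h : S ⊆ R) (f : ℕ → E)
    (n : ℕ) : matApply K R (fun m => if m ∈ S then f m else 0) n = matApply K S f n := by
  rw [matApply, matApply, ← Finset.sum_subset h]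
  · exact Finset.sum_congr rfl fun m hm => by rw [if_pos hm]
  · intro m _ hm
    rw [if_neg hm, map_zero]

theorem sum_indicator_mul {S R : Finset ℕ} (h : S ⊆ R) (f : ℕ → E) (φ : ℕ → E → ℝ)
    (hφ : ∀ n, φ n 0 = 0) :
    ∑ m ∈ R, φ m (if m ∈ S then f m else 0) = ∑ m ∈ S, φ m (f m) := by
  rw [← Finset.sum_subset h]
  · exact Finset.sum_congr rfl fun m hm => by rw [if_pos hm]
  · intro m _ hm
    rw [if_neg hm, hφ]

theorem exists_subset_range_two_pow (S : Finset ℕ) : ∃ N, S ⊆ Finset.range (2 ^ N) := by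
  obtain ⟨M, hM⟩ := S.exists_nat_subset_range
  exact ⟨M, hM.trans (Finset.range_subset_range.2 Nat.lt_two_pow_self.le)⟩

/-- Weak type `(1,1)` for an `A_1` weight, for arbitrary finite sets. -/
theorem weak_type {K : ℕ → ℕ → E →L[𝕜] F} {C : ℝ} (hC : 0 < C) (hK : HasOscBound K C)
    {w : ℕ → ℝ} (hw : ∀ n, 0 < w n) {A : ℝ} (hA : A1Bound w A) {q B : ℝ} (hq : 1 < q)
    (hB : 0 ≤ B)
    (hL : ∀ (N : ℕ) (f : ℕ → E),
      ∑ n ∈ Finset.range (2 ^ N), ‖matApply K (Finset.range (2 ^ N)) f n‖ ^ q * w n ≤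
        B * ∑ m ∈ Finset.range (2 ^ N), ‖f m‖ ^ q * w m) :
    ∃ C' : ℝ, 0 < C' ∧ ∀ (S W : Finset ℕ) (f : ℕ → E) (t : ℝ), 0 < t →
      t * ∑ n ∈ W with t < ‖matApply K S f n‖, w n ≤ C' * ∑ m ∈ S, ‖f m‖ * w m := by
  obtain ⟨C', hC', h⟩ := weak_type_window hC hK hw hA hq hB hL
  refine ⟨C', hC', fun S W f t ht => ?_⟩
  obtain ⟨N, hN⟩ := exists_subset_range_two_pow (S ∪ W)
  have h1 := h N (fun m => if m ∈ S then f m else 0) t ht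
  simp only [matApply_indicator K (Finset.union_subset_left hN)] at h1
  rw [sum_indicator_mul (Finset.union_subset_left hN) f (fun m v => ‖v‖ * w m) (by simp)] at h1
  refine le_trans (mul_le_mul_of_nonneg_left ?_ ht.le) h1
  exact Finset.sum_le_sum_of_subset_of_nonneg
    (Finset.filter_subset_filter _ (Finset.union_subset_right hN)) fun n _ _ => (hw n).le

/-! ### Sparse domination. -/

/-- The average of `‖f‖` over the triple of a dyadic interval, up to a bounded factor. -/
noncomputable def tripleAvg (f : ℕ → E) (k j : ℕ) : ℝ := (∑ m ∈ triple k j, ‖f m‖) / 2 ^ k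

theorem tripleAvg_nonneg (f : ℕ → E) (k j : ℕ) : 0 ≤ tripleAvg f k j :=
  div_nonneg (Finset.sum_nonneg fun _ _ => norm_nonneg _) (by positivity)

/-- The unweighted weak type `(1,1)` bound for a matrix. -/
def WeakBound (K : ℕ → ℕ → E →L[𝕜] F) (C : ℝ) : Prop :=
  ∀ (S W : Finset ℕ) (f : ℕ → E) (t : ℝ), 0 < t →
    t * ((W.filter fun n => t < ‖matApply K S f n‖).card : ℝ) ≤ C * ∑ m ∈ S, ‖f m‖

/-- The number of points where the dual Hardy operator is large. -/
theorem card_dualHardy_le {S W : Finset ℕ} {φ : ℕ → ℝ} (hφ : ∀ n, 0 ≤ φ n) (t : ℝ) :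
    t * ((W.filter fun n => t < ∑ m ∈ S with n ≤ m, φ m / ((m : ℝ) + 1)).card : ℝ) ≤
      ∑ m ∈ S, φ m := by
  have h := chebyshev_sum (s := W) (w := fun _ => 1)
    (X := fun n => ∑ m ∈ S with n ≤ m, φ m / ((m : ℝ) + 1)) (fun _ => zero_le_one)
    (fun n => Finset.sum_nonneg fun m _ => div_nonneg (hφ m) (by positivity)) t
  rw [Finset.sum_const, nsmul_eq_mul, mul_one] at h
  refine h.trans ?_
  simp only [mul_one, Finset.sum_filter]
  -- After interchanging the sums each m is counted at most m + 1 times, which cancels its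
  -- denominator.
  rw [Finset.sum_comm]
  refine Finset.sum_le_sum fun m _ => ?_
  rw [← Finset.sum_filter, Finset.sum_const, nsmul_eq_mul]
  have hc : ((W.filter fun n => n ≤ m).card : ℝ) ≤ m + 1 := by
    have : (W.filter fun n => n ≤ m) ⊆ Finset.range (m + 1) := by
      intro n hn
      rw [Finset.mem_range]
      exact Nat.lt_succ_of_le (Finset.mem_filter.1 hn).2
    have := Finset.card_le_card this
    rw [Finset.card_range] at this
    exact_mod_cast this
  have h1 : 0 ≤ φ m / ((m : ℝ) + 1) := div_nonneg (hφ m) (by positivity)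
  calc _ ≤ ((m : ℝ) + 1) * (φ m / ((m : ℝ) + 1)) := by gcongr
    _ = φ m := by field_simp

/-- Outside of a small part of a dyadic interval, both the operator and its off-diagonal oscillations
are controlled by the average. -/
theorem exists_small_exceptional {K : ℕ → ℕ → E →L[𝕜] F} {C₁ : ℝ} (hC₁ : 0 < C₁)
    (hweak : WeakBound K C₁) :
    ∃ c : ℝ, 0 < c ∧ ∀ (k j : ℕ) (f : ℕ → E), ∃ X ⊆ dyadic k j, 8 * X.card ≤ 2 ^ k ∧
      ∀ y ∈ dyadic k j, y ∉ X →
        ‖matApply K (triple k j) f y‖ ≤ c * tripleAvg f k j ∧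
        ∀ (i : ℕ) (s : Finset ℕ), s ⊆ triple k j → (∀ m ∈ s, m ∉ triple i (y / 2 ^ i)) →
          ∑ m ∈ s, oscMajorant i y m * ‖f m‖ ≤ 6 * (c * tripleAvg f k j) := by
  classical
  -- Three exceptional sets, each at most 1/24 of the interval, make up 1/8. They need c ≥ 24 C₁ for
  -- the operator, 24 for the dual Hardy sum and 24 · 9 for the maximal function (doubling constant
  -- 3, height Λ/3).
  refine ⟨24 * C₁ + 216, by positivity, fun k j f => ?_⟩
  set c := 24 * C₁ + 216 with hc
  -- The weak bound needs a positive height, so a vanishing average, where f is zero on the triple,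
  -- is treated apart.
  rcases (tripleAvg_nonneg f k j).eq_or_lt with h0 | hpos
  · have hf : ∀ m ∈ triple k j, f m = 0 := by
      rw [tripleAvg, eq_comm, div_eq_zero_iff,
        Finset.sum_eq_zero_iff_of_nonneg (fun _ _ => norm_nonneg _)] at h0
      intro m hm
      exact norm_eq_zero.1 (h0.resolve_right (by positivity) m hm)
    refine ⟨∅, Finset.empty_subset _, by simp, fun y _ _ => ⟨?_, fun i s hs _ => ?_⟩⟩
    · rw [← h0, matApply, Finset.sum_eq_zero fun m hm => by rw [hf m hm, map_zero]]
      simp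
    · rw [← h0, Finset.sum_eq_zero fun m hm => by rw [hf m (hs hm), norm_zero, mul_zero]]
      simp
  set Λ := c * tripleAvg f k j with hΛ
  have hΛ0 : 0 < Λ := by positivity
  have hsum : ∑ m ∈ triple k j, ‖f m‖ = tripleAvg f k j * 2 ^ k := by
    rw [tripleAvg, div_mul_cancel₀ _ (by positivity)]
  obtain ⟨N, hN⟩ := exists_subset_range_two_pow (triple k j)
  set φ : ℕ → ℝ := fun m => if m ∈ triple k j then ‖f m‖ else 0 with hφdef
  have hφ : ∀ m, 0 ≤ φ m := by
    intro m
    rw [hφdef]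
    dsimp only
    split_ifs
    · exact norm_nonneg _
    · exact le_rfl
  have hφsum : ∀ s ⊆ triple k j, ∀ ψ : ℕ → ℝ, ∑ m ∈ s, ψ m * ‖f m‖ = ∑ m ∈ s, ψ m * φ m := by
    intro s hs ψ
    refine Finset.sum_congr rfl fun m hm => ?_
    rw [hφdef]
    dsimp only
    rw [if_pos (hs hm)]
  have hφR : ∑ m ∈ Finset.range (2 ^ N), φ m = tripleAvg f k j * 2 ^ k := by
    rw [← hsum, ← Finset.sum_subset hN]
    · exact Finset.sum_congr rfl fun m hm => by rw [hφdef]; dsimp only; rw [if_pos hm]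
    · intro m _ hm
      rw [hφdef]
      dsimp only
      rw [if_neg hm]
  set X₁ := (dyadic k j).filter fun n => Λ < ‖matApply K (triple k j) f n‖ with hX₁
  set X₂ := (dyadic k j).filter fun n =>
    Λ < ∑ m ∈ triple k j with n ≤ m, ‖f m‖ / ((m : ℝ) + 1) with hX₂
  set X₃ := (dyadic k j).filter fun n => ∃ i ≤ N,
    Λ / 3 * ∑ y ∈ triple i (n / 2 ^ i), (1 : ℝ) < ∑ y ∈ triple i (n / 2 ^ i), φ y with hX₃
  have hbound : ∀ (Y : Finset ℕ) (M : ℝ), Λ * Y.card ≤ M * (tripleAvg f k j * 2 ^ k) →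
      24 * M ≤ c → 24 * Y.card ≤ 2 ^ k := by
    intro Y M h1 h2
    rw [hΛ] at h1
    have h3 : tripleAvg f k j * (c * Y.card) ≤ tripleAvg f k j * (M * 2 ^ k) := by linarith
    have h4 := le_of_mul_le_mul_left h3 hpos
    have h5 : c * (24 * (Y.card : ℝ)) ≤ c * 2 ^ k := by
      have : (24 * M) * (2 : ℝ) ^ k ≤ c * 2 ^ k := by gcongr
      linarith
    have h6 := le_of_mul_le_mul_left h5 (by positivity)
    exact_mod_cast h6
  have h₁ : 24 * X₁.card ≤ 2 ^ k := by
    refine hbound _ C₁ ?_ (by linarith)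
    rw [← hsum]
    exact hweak _ _ f Λ hΛ0
  have h₂ : 24 * X₂.card ≤ 2 ^ k := by
    refine hbound _ 1 ?_ (by linarith)
    rw [← hsum, one_mul]
    exact card_dualHardy_le (fun n => norm_nonneg (f n)) Λ
  have h₃ : 24 * X₃.card ≤ 2 ^ k := by
    refine hbound _ 9 ?_ (by linarith)
    have := weak_maximal (μ := fun _ => 1) (fun _ => zero_le_one) (D := 3) (by norm_num)
      (fun k j => by
        have : ((triple k j).card : ℝ) ≤ 3 * 2 ^ k := by exact_mod_cast card_triple_le k j
        simpa [card_dyadic] using this) (N := N) (a := φ) hφ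
      (fun n hn => by
        rw [hφdef]
        dsimp only
        rw [if_neg]
        intro hmem
        have := Finset.mem_range.1 (hN hmem)
        omega) (t := Λ / 3) (by positivity) (s := X₃) (fun x hx => (Finset.mem_filter.1 hx).2)
    rw [hφR, Finset.sum_const, nsmul_eq_mul, mul_one] at this
    linarith
  refine ⟨X₁ ∪ X₂ ∪ X₃, ?_, ?_, ?_⟩
  · exact Finset.union_subset (Finset.union_subset (Finset.filter_subset _ _)
      (Finset.filter_subset _ _)) (Finset.filter_subset _ _)
  · have e1 := Finset.card_union_le (X₁ ∪ X₂) X₃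
    have e2 := Finset.card_union_le X₁ X₂
    omega
  · intro y hy hyX
    simp only [Finset.mem_union, hX₁, hX₂, hX₃, Finset.mem_filter, not_or, not_and, not_lt,
      not_exists] at hyX
    obtain ⟨⟨hy1, hy2⟩, hy3⟩ := hyX
    refine ⟨hy1 hy, fun i s hs hsi => ?_⟩
    have hy2 := hy2 hy
    have hyN : y < 2 ^ N := Finset.mem_range.1 (hN (dyadic_subset_triple k j hy))
    have hmax : ∀ l ≤ N, ∑ n ∈ triple l (y / 2 ^ l), φ n ≤ 2 ^ l * Λ := by
      intro l hl
      refine (hy3 hy l hl).trans ?_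
      rw [Finset.sum_const, nsmul_eq_mul, mul_one]
      have : ((triple l (y / 2 ^ l)).card : ℝ) ≤ 3 * 2 ^ l := by
        exact_mod_cast card_triple_le _ _
      calc Λ / 3 * ((triple l (y / 2 ^ l)).card : ℝ) ≤ Λ / 3 * (3 * 2 ^ l) := by gcongr
        _ = _ := by ring
    -- The factor 6 is 4 for the Poisson sum and 1 for each of the two Hardy sums.
    have e1 : ∑ m ∈ s, 2 ^ i / |(m : ℝ) - y| ^ 2 * φ m ≤ 4 * Λ :=
      sum_poisson_le hyN hφ hΛ0.le hmax (hs.trans hN)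
        fun n hn => two_pow_le_abs_of_notMem_triple (hsi n hn)
    have e2 := sum_hardy_le hyN hφ hΛ0.le hmax
    have e3 : ∑ m ∈ s, 1 / (max (y : ℝ) m + 1) * φ m ≤
        ∑ m ∈ s with m ≤ y, φ m / ((y : ℝ) + 1) + ∑ m ∈ s with y ≤ m, φ m / ((m : ℝ) + 1) := by
      rw [Finset.sum_filter, Finset.sum_filter, ← Finset.sum_add_distrib]
      refine Finset.sum_le_sum fun m _ => ?_
      have := hφ m
      rcases le_total m y with h | h
      · rw [if_pos h, max_eq_left (by exact_mod_cast h), one_div_mul_eq_div]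
        have : 0 ≤ if y ≤ m then φ m / ((m : ℝ) + 1) else 0 := by split_ifs <;> positivity
        linarith
      · rw [if_pos h, max_eq_right (by exact_mod_cast h), one_div_mul_eq_div]
        have : 0 ≤ if m ≤ y then φ m / ((y : ℝ) + 1) else 0 := by split_ifs <;> positivity
        linarith
    have e4 : ∑ m ∈ s with m ≤ y, φ m / ((y : ℝ) + 1) ≤ Λ := by
      refine le_trans (Finset.sum_le_sum_of_subset_of_nonneg ?_ fun m _ _ => ?_) e2
      · intro m hm
        rw [Finset.mem_range]
        exact Nat.lt_succ_of_le (Finset.mem_filter.1 hm).2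
      · exact div_nonneg (hφ m) (by positivity)
    have e5 : ∑ m ∈ s with y ≤ m, φ m / ((m : ℝ) + 1) ≤ Λ := by
      refine le_trans ?_ hy2
      calc ∑ m ∈ s with y ≤ m, φ m / ((m : ℝ) + 1)
          = ∑ m ∈ s with y ≤ m, ‖f m‖ / ((m : ℝ) + 1) := by
            refine Finset.sum_congr rfl fun m hm => ?_
            rw [hφdef]
            dsimp only
            rw [if_pos (hs (Finset.mem_filter.1 hm).1)]
        _ ≤ _ := Finset.sum_le_sum_of_subset_of_nonneg (Finset.filter_subset_filter _ hs)
            fun m _ _ => by positivity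
    rw [hφsum s hs]
    simp only [oscMajorant, add_mul]
    rw [Finset.sum_add_distrib]
    linarith

/-- Sparse domination, in the form of an induction over dyadic intervals. -/
theorem sparse_bound {K : ℕ → ℕ → E →L[𝕜] F} {C C₁ : ℝ} (hC : 0 < C) (hK : HasOscBound K C)
    (hC₁ : 0 < C₁) (hweak : WeakBound K C₁) :
    ∃ C₂ : ℝ, 0 < C₂ ∧ ∀ (f : ℕ → E) (G Φ : ℕ → ℝ), (∀ n, 0 ≤ G n) → ∀ k : ℕ,
      (∀ (i l : ℕ) (s : Finset ℕ), i ≤ k → s ⊆ dyadic i l → 2 ^ i ≤ 2 * s.card →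
        tripleAvg f i l * ∑ n ∈ dyadic i l, G n ≤ ∑ n ∈ s, Φ n) →
      ∀ j, ∑ n ∈ dyadic k j, ‖matApply K (triple k j) f n‖ * G n ≤
        C₂ * ∑ n ∈ dyadic k j, Φ n := by
  classical
  obtain ⟨c, hc, hX⟩ := exists_small_exceptional hC₁ hweak
  refine ⟨(6 * C + 2) * c, by positivity, fun f G Φ hG k H => ?_⟩
  -- The induction carries the average term on the left, because passing from an interval to a
  -- stopping subinterval P creates the error c · `tripleAvg` on P, which the inequality on P has to
  -- absorb.
  suffices h : ∀ j, c * tripleAvg f k j * ∑ n ∈ dyadic k j, G n +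
      ∑ n ∈ dyadic k j, ‖matApply K (triple k j) f n‖ * G n ≤
        (6 * C + 2) * c * ∑ n ∈ dyadic k j, Φ n by
    intro j
    have h1 := h j
    have h2 : 0 ≤ c * tripleAvg f k j * ∑ n ∈ dyadic k j, G n :=
      mul_nonneg (mul_nonneg hc.le (tripleAvg_nonneg f k j)) (Finset.sum_nonneg fun n _ => hG n)
    linarith
  induction k using Nat.strong_induction_on with
  | _ k ih =>
  intro j
  obtain ⟨X, hXQ, hXcard, hXgood⟩ := hX k j f
  set Λ := c * tripleAvg f k j with hΛ
  have hΛ0 : 0 ≤ Λ := mul_nonneg hc.le (tripleAvg_nonneg f k j)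
  obtain ⟨N, hN⟩ := exists_subset_range_two_pow (dyadic k j)
  -- Stopping intervals are those where X has density above 1/4. As X fills at most 1/8 of the
  -- interval, the interval itself does not stop; maximality bounds the density in a stopping
  -- interval by 1/2; and together the stopping intervals cover at most 4 |X|, half of the interval.
  obtain ⟨𝓜, h1, hd, h3⟩ := exists_maximal_dyadic (N + k)
    (fun i l => i ≤ k ∧ 2 ^ i < 4 * (dyadic i l ∩ X).card)
  have hN' : dyadic k j ⊆ Finset.range (2 ^ (N + k)) :=
    hN.trans (Finset.range_subset_range.2 (Nat.pow_le_pow_right (by norm_num) (by omega)))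
  have hlt : ∀ P ∈ 𝓜, P.1 < k := by
    intro P hP
    obtain ⟨-, ⟨hPk, hB⟩, -⟩ := h1 P hP
    refine lt_of_le_of_ne hPk fun heq => ?_
    have := Finset.card_le_card (Finset.inter_subset_right (s₁ := dyadic P.1 P.2) (s₂ := X))
    rw [heq] at hB this
    omega
  have hsub : ∀ P ∈ 𝓜, ∃ x, x / 2 ^ k = j ∧ x / 2 ^ P.1 = P.2 := by
    intro P hP
    obtain ⟨-, ⟨-, hB⟩, -⟩ := h1 P hP
    have : 0 < (dyadic P.1 P.2 ∩ X).card := by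
      by_contra h0
      have h0 : (dyadic P.1 P.2 ∩ X).card = 0 := by omega
      rw [h0] at hB
      exact Nat.not_lt_zero _ hB
    obtain ⟨x, hx⟩ := Finset.card_pos.1 this
    rw [Finset.mem_inter] at hx
    exact ⟨x, mem_dyadic.1 (hXQ hx.2), mem_dyadic.1 hx.1⟩
  have hPQ : ∀ P ∈ 𝓜, dyadic P.1 P.2 ⊆ dyadic k j := by
    intro P hP
    obtain ⟨x, hx1, hx2⟩ := hsub P hP
    rw [← hx1, ← hx2]
    exact dyadic_subset_of_mem (hlt P hP).le
  have hPQ3 : ∀ P ∈ 𝓜, triple P.1 P.2 ⊆ triple k j := by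
    intro P hP
    obtain ⟨x, hx1, hx2⟩ := hsub P hP
    rw [← hx1, ← hx2]
    exact triple_subset_of_le (hlt P hP).le
  have hhalf : ∀ P ∈ 𝓜, 2 * (dyadic P.1 P.2 ∩ X).card ≤ 2 ^ P.1 := by
    intro P hP
    obtain ⟨x, hx⟩ := dyadic_nonempty P.1 P.2
    have hlt' := hlt P hP
    have hmax := (h1 P hP).2.2.2 x hx (P.1 + 1) (by omega) (by omega)
    have hsub' : dyadic P.1 P.2 ⊆ dyadic (P.1 + 1) (x / 2 ^ (P.1 + 1)) := by
      rw [← mem_dyadic.1 hx]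
      exact dyadic_subset_of_mem (by omega)
    have hcard := Finset.card_le_card (Finset.inter_subset_inter_right (u := X) hsub')
    rw [not_and, not_lt] at hmax
    have hmax := hmax (by omega)
    have : 2 ^ (P.1 + 1) = 2 * 2 ^ P.1 := by ring
    omega
  set U := 𝓜.biUnion (fun P => dyadic P.1 P.2) with hU
  have hUQ : U ⊆ dyadic k j := Finset.biUnion_subset.2 hPQ
  have hXU : X ⊆ U := by
    intro x hx
    obtain ⟨P, hP, hxP, -⟩ := h3 x (Finset.mem_range.1 (hN' (hXQ hx))) 0 (Nat.zero_le _) (by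
      have : x ∈ dyadic 0 (x / 2 ^ 0) ∩ X := Finset.mem_inter.2 ⟨mem_dyadic_self 0 x, hx⟩
      have := Finset.card_pos.2 ⟨x, this⟩
      refine ⟨Nat.zero_le _, ?_⟩
      rw [pow_zero] at this ⊢
      omega)
    exact Finset.mem_biUnion.2 ⟨P, hP, hxP⟩
  have hUcard : 2 * U.card ≤ 2 ^ k := by
    have e1 : U.card = ∑ P ∈ 𝓜, 2 ^ P.1 := by
      rw [hU, Finset.card_biUnion hd]
      exact Finset.sum_congr rfl fun P _ => card_dyadic _ _
    have e2 : ∑ P ∈ 𝓜, 2 ^ P.1 ≤ ∑ P ∈ 𝓜, 4 * (dyadic P.1 P.2 ∩ X).card :=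
      Finset.sum_le_sum fun P hP => (h1 P hP).2.1.2.le
    have e3 : ∑ P ∈ 𝓜, (dyadic P.1 P.2 ∩ X).card ≤ X.card := by
      rw [← Finset.card_biUnion fun P hP R hR hPR => by
        exact (hd hP hR hPR).mono Finset.inter_subset_left Finset.inter_subset_left]
      exact Finset.card_le_card (Finset.biUnion_subset.2 fun P _ => Finset.inter_subset_right)
    rw [← Finset.mul_sum] at e2
    omega
  have hkey : ∀ P ∈ 𝓜, ∀ x ∈ dyadic P.1 P.2, ‖matApply K (triple k j) f x‖ ≤
      ‖matApply K (triple P.1 P.2) f x‖ + (6 * C + 1) * Λ + c * tripleAvg f P.1 P.2 := by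
    intro P hP x hx
    obtain ⟨Y, hYP, hYcard, hYgood⟩ := hX P.1 P.2 f
    -- X takes at most half of P and the exceptional set of P at most an eighth, so some y in P is
    -- good for both intervals. At y both truncated operators are bounded, and their difference
    -- involves only entries off the triple of P, so from y to x it changes by at most 6 C Λ.
    obtain ⟨y, hy⟩ : (dyadic P.1 P.2 \ (dyadic P.1 P.2 ∩ X ∪ Y)).Nonempty := by
      rw [← Finset.card_pos]
      have e1 := Finset.le_card_sdiff (dyadic P.1 P.2 ∩ X ∪ Y) (dyadic P.1 P.2)
      have e2 := Finset.card_union_le (dyadic P.1 P.2 ∩ X) Y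
      have e3 := hhalf P hP
      have e4 : 0 < 2 ^ P.1 := by positivity
      rw [card_dyadic] at e1
      omega
    simp only [Finset.mem_sdiff, Finset.mem_union, Finset.mem_inter, not_or, not_and] at hy
    obtain ⟨hyP, hyX, hyY⟩ := hy
    have g1 := (hYgood y hyP hyY).1
    obtain ⟨g2, g3⟩ := hXgood y (hPQ P hP hyP) (hyX hyP)
    have hyP' := mem_dyadic.1 hyP
    have hsplit : ∀ n, matApply K (triple k j) f n =
        matApply K (triple k j \ triple P.1 P.2) f n + matApply K (triple P.1 P.2) f n :=
      fun n => (Finset.sum_sdiff (hPQ3 P hP)).symm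
    have g4 : ‖matApply K (triple k j \ triple P.1 P.2) f x -
        matApply K (triple k j \ triple P.1 P.2) f y‖ ≤ C * (6 * Λ) := by
      refine le_trans ?_ (mul_le_mul_of_nonneg_left (g3 P.1 (triple k j \ triple P.1 P.2)
        Finset.sdiff_subset fun m hm => ?_) hC.le)
      · rw [matApply, matApply, ← Finset.sum_sub_distrib, Finset.mul_sum]
        refine (norm_sum_le _ _).trans (Finset.sum_le_sum fun m hm => ?_)
        rw [← sub_apply, ← mul_assoc]
        refine (ContinuousLinearMap.le_opNorm _ _).trans ?_
        gcongr
        refine hK.left ((mem_dyadic.1 hx).trans hyP'.symm) ?_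
        rw [hyP']
        exact (Finset.mem_sdiff.1 hm).2
      · rw [hyP']
        exact (Finset.mem_sdiff.1 hm).2
    have e : matApply K (triple k j) f x = matApply K (triple P.1 P.2) f x +
        (matApply K (triple k j \ triple P.1 P.2) f x -
          matApply K (triple k j \ triple P.1 P.2) f y) +
        (matApply K (triple k j) f y - matApply K (triple P.1 P.2) f y) := by
      rw [hsplit x, hsplit y]
      abel
    rw [e]
    refine (norm_add₃_le).trans ?_
    have := norm_sub_le (matApply K (triple k j) f y) (matApply K (triple P.1 P.2) f y)
    linarith
  have hcardE : 2 ^ k ≤ 2 * (dyadic k j \ U).card := by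
    have := Finset.card_sdiff_add_card_eq_card hUQ
    rw [card_dyadic] at this
    omega
  have hE := H k j (dyadic k j \ U) le_rfl Finset.sdiff_subset hcardE
  have hGE : 0 ≤ ∑ n ∈ dyadic k j \ U, G n := Finset.sum_nonneg fun n _ => hG n
  have s1 : ∑ n ∈ dyadic k j \ U, ‖matApply K (triple k j) f n‖ * G n ≤
      Λ * ∑ n ∈ dyadic k j \ U, G n := by
    rw [Finset.mul_sum]
    refine Finset.sum_le_sum fun n hn => mul_le_mul_of_nonneg_right ?_ (hG n)
    rw [Finset.mem_sdiff] at hn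
    exact (hXgood n hn.1 fun h => hn.2 (hXU h)).1
  have s2 : ∑ n ∈ U, ‖matApply K (triple k j) f n‖ * G n ≤
      (6 * C + 1) * Λ * ∑ n ∈ U, G n + (6 * C + 2) * c * ∑ n ∈ U, Φ n := by
    rw [hU, Finset.sum_biUnion hd, Finset.sum_biUnion hd, Finset.sum_biUnion hd, Finset.mul_sum,
      Finset.mul_sum, ← Finset.sum_add_distrib]
    refine Finset.sum_le_sum fun P hP => ?_
    have := ih P.1 (hlt P hP) (fun i l s hi => H i l s (hi.trans (hlt P hP).le)) P.2
    calc ∑ n ∈ dyadic P.1 P.2, ‖matApply K (triple k j) f n‖ * G n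
        ≤ ∑ n ∈ dyadic P.1 P.2, (‖matApply K (triple P.1 P.2) f n‖ * G n +
          (6 * C + 1) * Λ * G n + c * tripleAvg f P.1 P.2 * G n) := by
          refine Finset.sum_le_sum fun n hn => ?_
          rw [← add_mul, ← add_mul]
          exact mul_le_mul_of_nonneg_right (hkey P hP n hn) (hG n)
      _ = ∑ n ∈ dyadic P.1 P.2, ‖matApply K (triple P.1 P.2) f n‖ * G n +
          (6 * C + 1) * Λ * ∑ n ∈ dyadic P.1 P.2, G n +
          c * tripleAvg f P.1 P.2 * ∑ n ∈ dyadic P.1 P.2, G n := by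
          rw [Finset.sum_add_distrib, Finset.sum_add_distrib, ← Finset.mul_sum, ← Finset.mul_sum]
      _ ≤ _ := by linarith
  have s3 : ∑ n ∈ dyadic k j, ‖matApply K (triple k j) f n‖ * G n =
      ∑ n ∈ dyadic k j \ U, ‖matApply K (triple k j) f n‖ * G n +
        ∑ n ∈ U, ‖matApply K (triple k j) f n‖ * G n := (Finset.sum_sdiff hUQ).symm
  have s4 : ∑ n ∈ dyadic k j, G n = ∑ n ∈ dyadic k j \ U, G n + ∑ n ∈ U, G n :=
    (Finset.sum_sdiff hUQ).symm
  have s5 : ∑ n ∈ dyadic k j, Φ n = ∑ n ∈ dyadic k j \ U, Φ n + ∑ n ∈ U, Φ n :=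
    (Finset.sum_sdiff hUQ).symm
  -- Each point costs at most (6C + 1) Λ, and the strengthened left side adds one more Λ.
  have s6 : (6 * C + 2) * (Λ * ∑ n ∈ dyadic k j, G n) ≤
      (6 * C + 2) * c * ∑ n ∈ dyadic k j \ U, Φ n := by
    rw [hΛ, mul_assoc c, mul_assoc (6 * C + 2)]
    gcongr
  have s7 : Λ * ∑ n ∈ dyadic k j \ U, G n ≤ (6 * C + 1) * Λ * ∑ n ∈ dyadic k j \ U, G n := by
    have : 0 ≤ 6 * C * (Λ * ∑ n ∈ dyadic k j \ U, G n) := by positivity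
    linarith
  rw [s3, s5]
  rw [s4] at s6 ⊢
  linarith

/-! ### Dual pairs of weights and the testing condition. -/

/-- A weight together with its dual weight, in a form symmetric under duality. -/
structure DualWeights (p q : ℝ) (w σ : ℕ → ℝ) (A : ℝ) : Prop where
  conj : p.HolderConjugate q
  pos : ∀ n, 0 < w n
  pos' : ∀ n, 0 < σ n
  mul_eq_one : ∀ n, w n ^ (1 / p) * σ n ^ (1 / q) = 1
  const_pos : 0 < A
  bound : ∀ a b : ℕ, (∑ n ∈ Finset.Ico a b, w n) ^ (1 / p) * (∑ n ∈ Finset.Ico a b, σ n) ^ (1 / q) ≤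
    A * (Finset.Ico a b).card

namespace DualWeights

variable {p q : ℝ} {w σ : ℕ → ℝ} {A : ℝ}

theorem symm (h : DualWeights p q w σ A) : DualWeights q p σ w A where
  conj := h.conj.symm
  pos := h.pos'
  pos' := h.pos
  mul_eq_one n := by rw [mul_comm, h.mul_eq_one]
  const_pos := h.const_pos
  bound a b := by rw [mul_comm]; exact h.bound a b

theorem dual_rpow (h : DualWeights p q w σ A) (n : ℕ) : σ n ^ (1 - p) = w n := by
  have hp := h.conj.pos
  have hw := h.pos n
  have hσ := h.pos' n
  have h1 := congrArg (· ^ p) (h.mul_eq_one n)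
  rw [Real.mul_rpow (by positivity) (by positivity), ← Real.rpow_mul hw.le, ← Real.rpow_mul hσ.le,
    one_div_mul_cancel hp.ne', Real.rpow_one, Real.one_rpow, one_div_mul_eq_div,
    h.conj.div_conj_eq_sub_one] at h1
  rw [show 1 - p = -(p - 1) by ring, Real.rpow_neg hσ.le]
  exact (eq_inv_of_mul_eq_one_left h1).symm

/-- Hölder on s gives |s| ≤ w(s)^(1/p) σ(s)^(1/q). Multiplying by w(triple)^(1/p) and applying the
A_p bound on the triple removes σ, and |triple| ≤ 6 |s|. Thus any half of an interval carries a
fixed share of the weight of the triple. -/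
theorem sum_triple_le (h : DualWeights p q w σ A) {k j : ℕ} {s : Finset ℕ} (hs : s ⊆ triple k j)
    (hcard : 2 ^ k ≤ 2 * s.card) : ∑ n ∈ triple k j, w n ≤ (6 * A) ^ p * ∑ n ∈ s, w n := by
  have hp := h.conj.pos
  have hq := h.conj.symm.pos
  have hA := h.const_pos
  have hw0 : ∀ s : Finset ℕ, 0 ≤ ∑ n ∈ s, w n := fun s => Finset.sum_nonneg fun n _ => (h.pos n).le
  have hσ0 : ∀ s : Finset ℕ, 0 ≤ ∑ n ∈ s, σ n := fun s => Finset.sum_nonneg fun n _ => (h.pos' n).le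
  have h1 : (s.card : ℝ) ≤ (∑ n ∈ s, w n) ^ (1 / p) * (∑ n ∈ s, σ n) ^ (1 / q) := by
    have := Real.inner_le_Lp_mul_Lq_of_nonneg s h.conj (f := fun n => w n ^ (1 / p))
      (g := fun n => σ n ^ (1 / q)) (fun n _ => Real.rpow_nonneg (h.pos n).le _)
      (fun n _ => Real.rpow_nonneg (h.pos' n).le _)
    simp only [h.mul_eq_one, Finset.sum_const, nsmul_eq_mul, mul_one] at this
    refine this.trans_eq ?_
    congr 2
    · refine Finset.sum_congr rfl fun n _ => ?_
      rw [← Real.rpow_mul (h.pos n).le, one_div_mul_cancel hp.ne', Real.rpow_one]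
    · refine Finset.sum_congr rfl fun n _ => ?_
      rw [← Real.rpow_mul (h.pos' n).le, one_div_mul_cancel hq.ne', Real.rpow_one]
  have h2 : (∑ n ∈ s, σ n) ≤ ∑ n ∈ triple k j, σ n :=
    Finset.sum_le_sum_of_subset_of_nonneg hs fun n _ _ => (h.pos' n).le
  have h3 := h.bound ((j - 1) * 2 ^ k) ((j + 2) * 2 ^ k)
  rw [← triple] at h3
  have hc1 : ((triple k j).card : ℝ) ≤ 6 * s.card := by
    have := card_triple_le k j
    have : (triple k j).card ≤ 6 * s.card := by omega
    exact_mod_cast this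
  have hc0 : (0 : ℝ) < s.card := by
    have : 0 < 2 ^ k := by positivity
    have : 0 < s.card := by omega
    exact_mod_cast this
  have h4 : (s.card : ℝ) * (∑ n ∈ triple k j, w n) ^ (1 / p) ≤
      s.card * (6 * A * (∑ n ∈ s, w n) ^ (1 / p)) := by
    have := Real.rpow_nonneg (hw0 s) (1 / p)
    have := Real.rpow_nonneg (hw0 (triple k j)) (1 / p)
    calc (s.card : ℝ) * (∑ n ∈ triple k j, w n) ^ (1 / p)
        ≤ ((∑ n ∈ s, w n) ^ (1 / p) * (∑ n ∈ s, σ n) ^ (1 / q)) *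
          (∑ n ∈ triple k j, w n) ^ (1 / p) := by gcongr
      _ ≤ ((∑ n ∈ s, w n) ^ (1 / p) * (∑ n ∈ triple k j, σ n) ^ (1 / q)) *
          (∑ n ∈ triple k j, w n) ^ (1 / p) := by
          gcongr
          exact hσ0 _
      _ = (∑ n ∈ s, w n) ^ (1 / p) * ((∑ n ∈ triple k j, w n) ^ (1 / p) *
          (∑ n ∈ triple k j, σ n) ^ (1 / q)) := by ring
      _ ≤ (∑ n ∈ s, w n) ^ (1 / p) * (A * (triple k j).card) := by gcongr
      _ ≤ (∑ n ∈ s, w n) ^ (1 / p) * (A * (6 * s.card)) := by gcongr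
      _ = _ := by ring
  have h5 := le_of_mul_le_mul_left h4 hc0
  have h6 := Real.rpow_le_rpow (Real.rpow_nonneg (hw0 _) _) h5 hp.le
  rwa [Real.mul_rpow (by positivity) (Real.rpow_nonneg (hw0 _) _), ← Real.rpow_mul (hw0 _),
    ← Real.rpow_mul (hw0 _), one_div_mul_cancel hp.ne', Real.rpow_one, Real.rpow_one] at h6

theorem doubling (h : DualWeights p q w σ A) (k j : ℕ) :
    ∑ n ∈ triple k j, w n ≤ (6 * A) ^ p * ∑ n ∈ dyadic k j, w n :=
  h.sum_triple_le (dyadic_subset_triple k j) (by rw [card_dyadic]; omega)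

/-- Both masses are split into powers 1/p and 1/q. The pair w^(1/p) σ^(1/q) is bounded by the A_p
condition; the pair σ^(1/p) w^(1/q) is moved from the triple to s by `sum_triple_le` for the weight
and for its dual. -/
theorem sum_mul_sum_le (h : DualWeights p q w σ A) {k j : ℕ} {s : Finset ℕ} (hs : s ⊆ triple k j)
    (hcard : 2 ^ k ≤ 2 * s.card) :
    (∑ n ∈ triple k j, σ n) * ∑ n ∈ triple k j, w n ≤
      2 ^ k * (3 * A * (6 * A) ^ (q / p + p / q)) *
        ((∑ n ∈ s, σ n) ^ (1 / p) * (∑ n ∈ s, w n) ^ (1 / q)) := by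
  have hp := h.conj.pos
  have hq := h.conj.symm.pos
  have hA := h.const_pos
  have hw0 : ∀ s : Finset ℕ, 0 ≤ ∑ n ∈ s, w n := fun s => Finset.sum_nonneg fun n _ => (h.pos n).le
  have hσ0 : ∀ s : Finset ℕ, 0 ≤ ∑ n ∈ s, σ n := fun s => Finset.sum_nonneg fun n _ => (h.pos' n).le
  have hsplit : ∀ x : ℝ, 0 ≤ x → x ^ (1 / p) * x ^ (1 / q) = x := by
    intro x hx
    have := h.conj.inv_add_inv_eq_one
    rw [← Real.rpow_add_of_nonneg hx (by positivity) (by positivity), one_div, one_div, this,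
      Real.rpow_one]
  have h1 : (∑ n ∈ triple k j, σ n) ^ (1 / p) ≤ (6 * A) ^ (q / p) * (∑ n ∈ s, σ n) ^ (1 / p) := by
    have := Real.rpow_le_rpow (hσ0 _) (h.symm.sum_triple_le hs hcard) (one_div_pos.2 hp).le
    rwa [Real.mul_rpow (by positivity) (hσ0 _), ← Real.rpow_mul (by positivity),
      mul_one_div] at this
  have h2 : (∑ n ∈ triple k j, w n) ^ (1 / q) ≤ (6 * A) ^ (p / q) * (∑ n ∈ s, w n) ^ (1 / q) := by
    have := Real.rpow_le_rpow (hw0 _) (h.sum_triple_le hs hcard) (one_div_pos.2 hq).le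
    rwa [Real.mul_rpow (by positivity) (hw0 _), ← Real.rpow_mul (by positivity),
      mul_one_div] at this
  have h3 := h.bound ((j - 1) * 2 ^ k) ((j + 2) * 2 ^ k)
  rw [← triple] at h3
  have hc : ((triple k j).card : ℝ) ≤ 3 * 2 ^ k := by exact_mod_cast card_triple_le k j
  have hw1 := Real.rpow_nonneg (hw0 (triple k j)) (1 / q)
  have hσ1 := Real.rpow_nonneg (hσ0 s) (1 / p)
  have hw2 := Real.rpow_nonneg (hw0 s) (1 / q)
  have hσ2 := Real.rpow_nonneg (hσ0 (triple k j)) (1 / p)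
  calc (∑ n ∈ triple k j, σ n) * ∑ n ∈ triple k j, w n
      = ((∑ n ∈ triple k j, σ n) ^ (1 / p) * (∑ n ∈ triple k j, σ n) ^ (1 / q)) *
        ((∑ n ∈ triple k j, w n) ^ (1 / p) * (∑ n ∈ triple k j, w n) ^ (1 / q)) := by
        rw [hsplit _ (hσ0 _), hsplit _ (hw0 _)]
    _ = ((∑ n ∈ triple k j, w n) ^ (1 / p) * (∑ n ∈ triple k j, σ n) ^ (1 / q)) *
        ((∑ n ∈ triple k j, σ n) ^ (1 / p) * (∑ n ∈ triple k j, w n) ^ (1 / q)) := by ring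
    _ ≤ (A * (triple k j).card) *
        ((∑ n ∈ triple k j, σ n) ^ (1 / p) * (∑ n ∈ triple k j, w n) ^ (1 / q)) := by gcongr
    _ ≤ (A * (3 * 2 ^ k)) * (((6 * A) ^ (q / p) * (∑ n ∈ s, σ n) ^ (1 / p)) *
        ((6 * A) ^ (p / q) * (∑ n ∈ s, w n) ^ (1 / q))) := by gcongr
    _ = _ := by
        rw [Real.rpow_add (by positivity)]
        ring

/-- The testing condition of `sparse_bound` for a function and a dual function. -/
theorem avg_mul_sum_le (h : DualWeights p q w σ A) {E : Type*} [NormedAddCommGroup E] (f : ℕ → E)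
    {g : ℕ → ℝ} (hg : ∀ n, 0 ≤ g n) {N k j : ℕ} (hk : k ≤ N) {s : Finset ℕ} (hs : s ⊆ dyadic k j)
    (hcard : 2 ^ k ≤ 2 * s.card) :
    tripleAvg f k j * ∑ n ∈ dyadic k j, g n * w n ≤
      ∑ n ∈ s, 3 * A * (6 * A) ^ (q / p + p / q) *
        (tripleMax σ (fun m => ‖f m‖) N n ^ p * σ n +
          tripleMax w (fun m => g m * w m) N n ^ q * w n) := by
  have hp := h.conj.pos
  have hq := h.conj.symm.pos
  have hA := h.const_pos
  have hw0 : ∀ s : Finset ℕ, 0 ≤ ∑ n ∈ s, w n := fun s => Finset.sum_nonneg fun n _ => (h.pos n).le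
  have hσ0 : ∀ s : Finset ℕ, 0 ≤ ∑ n ∈ s, σ n := fun s => Finset.sum_nonneg fun n _ => (h.pos' n).le
  have hgw : ∀ n, 0 ≤ g n * w n := fun n => mul_nonneg (hg n) (h.pos n).le
  -- Averages relative to σ and to w lie below the corresponding maximal functions at every point of
  -- s. Young's inequality therefore gives a sum over s itself, in the form that the sparse
  -- induction adds up.
  set a := (∑ m ∈ triple k j, ‖f m‖) / ∑ m ∈ triple k j, σ m with ha
  set b := (∑ m ∈ triple k j, g m * w m) / ∑ m ∈ triple k j, w m with hb
  have ha0 : 0 ≤ a := div_nonneg (Finset.sum_nonneg fun _ _ => norm_nonneg _) (hσ0 _)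
  have hb0 : 0 ≤ b := div_nonneg (Finset.sum_nonneg fun _ _ => hgw _) (hw0 _)
  have hau : ∀ n ∈ s, a ≤ tripleMax σ (fun m => ‖f m‖) N n := by
    intro n hn
    have := le_tripleMax σ (fun m => ‖f m‖) hk n
    rwa [mem_dyadic.1 (hs hn)] at this
  have hbv : ∀ n ∈ s, b ≤ tripleMax w (fun m => g m * w m) N n := by
    intro n hn
    have := le_tripleMax w (fun m => g m * w m) hk n
    rwa [mem_dyadic.1 (hs hn)] at this
  have e1 : ∑ m ∈ triple k j, ‖f m‖ = a * ∑ m ∈ triple k j, σ m := by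
    rw [ha, div_mul_cancel₀ _ (sum_triple_pos h.pos' k j).ne']
  have e2 : ∑ m ∈ triple k j, g m * w m = b * ∑ m ∈ triple k j, w m := by
    rw [hb, div_mul_cancel₀ _ (sum_triple_pos h.pos k j).ne']
  have e3 : ∑ n ∈ dyadic k j, g n * w n ≤ ∑ m ∈ triple k j, g m * w m :=
    Finset.sum_le_sum_of_subset_of_nonneg (dyadic_subset_triple k j) fun n _ _ => hgw n
  set M := 3 * A * (6 * A) ^ (q / p + p / q) with hM
  have hM0 : 0 ≤ M := by positivity
  have hσs := hσ0 s
  have hws := hw0 s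
  calc tripleAvg f k j * ∑ n ∈ dyadic k j, g n * w n
      ≤ tripleAvg f k j * ∑ n ∈ triple k j, g n * w n :=
        mul_le_mul_of_nonneg_left e3 (tripleAvg_nonneg f k j)
    _ = a * b * ((∑ m ∈ triple k j, σ m) * ∑ m ∈ triple k j, w m) / 2 ^ k := by
        rw [tripleAvg, e1, e2]
        ring
    _ ≤ a * b * (2 ^ k * M * ((∑ n ∈ s, σ n) ^ (1 / p) * (∑ n ∈ s, w n) ^ (1 / q))) / 2 ^ k := by
        refine div_le_div_of_nonneg_right (mul_le_mul_of_nonneg_left ?_ (by positivity))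
          (by positivity)
        exact h.sum_mul_sum_le (hs.trans (dyadic_subset_triple k j)) hcard
    _ = M * ((a * (∑ n ∈ s, σ n) ^ (1 / p)) * (b * (∑ n ∈ s, w n) ^ (1 / q))) := by
        field_simp
    _ ≤ M * (a ^ p * ∑ n ∈ s, σ n + b ^ q * ∑ n ∈ s, w n) := by
        gcongr
        have := Real.young_inequality_of_nonneg (a := a * (∑ n ∈ s, σ n) ^ (1 / p))
          (b := b * (∑ n ∈ s, w n) ^ (1 / q)) (by positivity) (by positivity) h.conj
        rw [Real.mul_rpow ha0 (by positivity), Real.mul_rpow hb0 (by positivity),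
          ← Real.rpow_mul hσs, ← Real.rpow_mul hws, one_div_mul_cancel hp.ne',
          one_div_mul_cancel hq.ne', Real.rpow_one, Real.rpow_one] at this
        refine this.trans (add_le_add ?_ ?_)
        · exact div_le_self (by positivity) h.conj.lt.le
        · exact div_le_self (by positivity) h.conj.symm.lt.le
    _ = M * ∑ n ∈ s, (a ^ p * σ n + b ^ q * w n) := by
        rw [Finset.sum_add_distrib, Finset.mul_sum, Finset.mul_sum]
    _ ≤ M * ∑ n ∈ s, (tripleMax σ (fun m => ‖f m‖) N n ^ p * σ n +
          tripleMax w (fun m => g m * w m) N n ^ q * w n) := by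
        refine mul_le_mul_of_nonneg_left (Finset.sum_le_sum fun n hn => ?_) hM0
        have h1 := (h.pos' n).le
        have h2 := (h.pos n).le
        have h3 := hau n hn
        have h4 := hbv n hn
        gcongr
    _ = _ := Finset.mul_sum _ _ _

end DualWeights

/-! ### Strong type for `A_p` weights. -/

theorem div_rpow_mul_eq {x y v p : ℝ} (hx : 0 ≤ x) (hy : 0 < y) (h : y ^ (1 - p) = v) :
    (x / y) ^ p * y = x ^ p * v := by
  rw [← h, Real.div_rpow hx hy.le, Real.rpow_sub hy, Real.rpow_one]
  have : 0 < y ^ p := by positivity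
  field_simp

/-- Duality without normalization: the test function g = δ Θ^(p-1) has g^q = δ^q Θ^p, and δ^(q-1) =
1/(2C) makes its term on the right half of the left side. The sums being finite, that half can be
subtracted. -/
theorem absorb {p q : ℝ} (hpq : p.HolderConjugate q) {C : ℝ} (hC : 0 < C) :
    ∃ B : ℝ, 0 ≤ B ∧ ∀ (s : Finset ℕ) (w Θ : ℕ → ℝ) (Y : ℝ), (∀ n, 0 ≤ w n) → (∀ n, 0 ≤ Θ n) →
      (∀ g : ℕ → ℝ, (∀ n, 0 ≤ g n) →
        ∑ n ∈ s, Θ n * (g n * w n) ≤ C * (Y + ∑ n ∈ s, g n ^ q * w n)) →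
      ∑ n ∈ s, Θ n ^ p * w n ≤ B * Y := by
  have hq1 : 0 < q - 1 := by linarith [hpq.symm.lt]
  set δ := (1 / (2 * C)) ^ (1 / (q - 1)) with hδ
  have hδ0 : 0 < δ := by positivity
  have hδq : δ ^ q = δ * (1 / (2 * C)) := by
    have : δ ^ (q - 1) = 1 / (2 * C) := by
      rw [hδ, ← Real.rpow_mul (by positivity), one_div_mul_cancel hq1.ne', Real.rpow_one]
    rw [← this, mul_comm, ← Real.rpow_add_one hδ0.ne', sub_add_cancel]
  refine ⟨2 * C / δ, by positivity, fun s w Θ Y hw hΘ H => ?_⟩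
  have h1 := H (fun n => δ * Θ n ^ (p - 1))
    (fun n => mul_nonneg hδ0.le (Real.rpow_nonneg (hΘ n) _))
  have e1 : ∑ n ∈ s, Θ n * (δ * Θ n ^ (p - 1) * w n) = δ * ∑ n ∈ s, Θ n ^ p * w n := by
    rw [Finset.mul_sum]
    refine Finset.sum_congr rfl fun n _ => ?_
    have : Θ n ^ p = Θ n ^ (p - 1) * Θ n := by
      rcases (hΘ n).eq_or_lt with h0 | h0
      · rw [← h0, Real.zero_rpow hpq.pos.ne', mul_zero]
      · rw [← Real.rpow_add_one h0.ne', sub_add_cancel]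
    rw [this]
    ring
  have e2 : ∑ n ∈ s, (δ * Θ n ^ (p - 1)) ^ q * w n =
      δ * (1 / (2 * C)) * ∑ n ∈ s, Θ n ^ p * w n := by
    rw [Finset.mul_sum]
    refine Finset.sum_congr rfl fun n _ => ?_
    rw [Real.mul_rpow hδ0.le (Real.rpow_nonneg (hΘ n) _), hδq, ← Real.rpow_mul (hΘ n),
      hpq.sub_one_mul_conj]
    ring
  simp only [e1, e2] at h1
  set Z := ∑ n ∈ s, Θ n ^ p * w n
  have e3 : C * (Y + δ * (1 / (2 * C)) * Z) = C * Y + δ / 2 * Z := by field_simp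
  rw [e3] at h1
  rw [div_mul_eq_mul_div, le_div_iff₀ hδ0]
  linarith

/-- Weighted strong type bounds for `A_p` weights. -/
theorem strong_type_window {K : ℕ → ℕ → E →L[𝕜] F} {C C₁ : ℝ} (hC : 0 < C) (hK : HasOscBound K C)
    (hC₁ : 0 < C₁) (hweak : WeakBound K C₁) {p q : ℝ} {w σ : ℕ → ℝ} {A : ℝ}
    (h : DualWeights p q w σ A) :
    ∃ B : ℝ, 0 ≤ B ∧ ∀ (N : ℕ) (f : ℕ → E),
      ∑ n ∈ Finset.range (2 ^ N), ‖matApply K (Finset.range (2 ^ N)) f n‖ ^ p * w n ≤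
        B * ∑ m ∈ Finset.range (2 ^ N), ‖f m‖ ^ p * w m := by
  classical
  obtain ⟨C₂, hC₂, hsp⟩ := sparse_bound hC hK hC₁ hweak
  have hp := h.conj.lt
  have hq := h.conj.symm.lt
  have hA := h.const_pos
  have hp0 := h.conj.pos
  have hq0 := h.conj.symm.pos
  have hp1 : 0 < p - 1 := by linarith
  have hq1 : 0 < q - 1 := by linarith
  set M := 3 * A * (6 * A) ^ (q / p + p / q) with hM
  set c₁ := p * (2 * (6 * A) ^ q) * 2 ^ (p - 1) / (p - 1) with hc₁
  set c₂ := q * (2 * (6 * A) ^ p) * 2 ^ (q - 1) / (q - 1) with hc₂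
  have hc₁0 : 0 < c₁ := by positivity
  have hc₂0 : 0 < c₂ := by positivity
  have hM0 : 0 < M := by positivity
  obtain ⟨B, hB, habs⟩ := absorb h.conj (C := C₂ * (M * (c₁ + c₂))) (by positivity)
  refine ⟨B, hB, fun N f => habs _ w _ _ (fun n => (h.pos n).le) (fun n => norm_nonneg _)
    fun g₀ hg₀ => ?_⟩
  set R := Finset.range (2 ^ N) with hR
  set f' : ℕ → E := fun m => if m ∈ R then f m else 0 with hf'
  set g : ℕ → ℝ := fun m => if m ∈ R then g₀ m else 0 with hg
  have hg0 : ∀ n, 0 ≤ g n := by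
    intro n
    rw [hg]
    dsimp only
    split_ifs
    · exact hg₀ n
    · exact le_rfl
  have hgR : ∀ n ∈ R, g n = g₀ n := fun n hn => by rw [hg]; dsimp only; rw [if_pos hn]
  have hfR : ∀ n ∈ R, f' n = f n := fun n hn => by rw [hf']; dsimp only; rw [if_pos hn]
  have hout : ∀ n, 2 ^ N ≤ n → n ∉ R := fun n hn => by simpa [hR] using hn
  have hQ : dyadic N 0 = R := by
    rw [dyadic, hR, Finset.range_eq_Ico]
    simp
  have hRT : R ⊆ triple N 0 := by
    rw [← hQ]
    exact dyadic_subset_triple N 0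
  -- The window is the interval `dyadic N 0`. Cutting f to the window makes the operator on its
  -- triple coincide with the operator on the window.
  have hmain := hsp f' (fun n => g n * w n) _ (fun n => mul_nonneg (hg0 n) (h.pos n).le) N
    (fun i l s hi hs hcard => h.avg_mul_sum_le f' hg0 hi hs hcard) 0
  rw [hQ, ← Finset.mul_sum, Finset.sum_add_distrib] at hmain
  have e1 : ∑ n ∈ R, ‖matApply K (triple N 0) f' n‖ * (g n * w n) =
      ∑ n ∈ R, ‖matApply K R f n‖ * (g₀ n * w n) := by
    refine Finset.sum_congr rfl fun n hn => ?_
    rw [matApply_indicator K hRT, hgR n hn]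
  have e2 := strong_maximal h.pos' (D := (6 * A) ^ q) (by positivity) h.symm.doubling hp (N := N)
    (a := fun m => ‖f' m‖) (fun m => norm_nonneg _)
    (fun m hm => by rw [hf']; dsimp only; rw [if_neg (hout m hm), norm_zero])
  have e3 := strong_maximal h.pos (D := (6 * A) ^ p) (by positivity) h.doubling hq (N := N)
    (a := fun m => g m * w m) (fun m => mul_nonneg (hg0 m) (h.pos m).le)
    (fun m hm => by rw [hg]; dsimp only; rw [if_neg (hout m hm), zero_mul])
  -- The maximal bound relative to σ ends in ℓ^p(w) because σ^(1-p) = w.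
  have e4 : ∑ x ∈ R, (‖f' x‖ / σ x) ^ p * σ x = ∑ x ∈ R, ‖f x‖ ^ p * w x := by
    refine Finset.sum_congr rfl fun n hn => ?_
    rw [hfR n hn, div_rpow_mul_eq (norm_nonneg _) (h.pos' n) (h.dual_rpow n)]
  have e5 : ∑ x ∈ R, (g x * w x / w x) ^ q * w x = ∑ x ∈ R, g₀ x ^ q * w x := by
    refine Finset.sum_congr rfl fun n hn => ?_
    rw [hgR n hn, mul_div_cancel_right₀ _ (h.pos n).ne']
  rw [e1] at hmain
  rw [← hR, e4, ← hc₁] at e2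
  rw [← hR, e5, ← hc₂] at e3
  set Y := ∑ x ∈ R, ‖f x‖ ^ p * w x
  set Y' := ∑ x ∈ R, g₀ x ^ q * w x
  have hY : 0 ≤ Y := Finset.sum_nonneg fun n _ =>
    mul_nonneg (Real.rpow_nonneg (norm_nonneg _) _) (h.pos n).le
  have hY' : 0 ≤ Y' := Finset.sum_nonneg fun n _ =>
    mul_nonneg (Real.rpow_nonneg (hg₀ n) _) (h.pos n).le
  calc ∑ n ∈ R, ‖matApply K R f n‖ * (g₀ n * w n) ≤ C₂ * (M * (c₁ * Y + c₂ * Y')) := by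
        refine hmain.trans ?_
        gcongr
    _ ≤ C₂ * (M * ((c₁ + c₂) * (Y + Y'))) := by
        gcongr
        have := mul_nonneg hc₁0.le hY'
        have := mul_nonneg hc₂0.le hY
        linarith
    _ = _ := by ring

/-- Weighted strong type bounds for arbitrary finite sets. -/
theorem strong_type {K : ℕ → ℕ → E →L[𝕜] F} {p B : ℝ} (hp : 1 < p) {w : ℕ → ℝ} (hw : ∀ n, 0 < w n)
    (h : ∀ (N : ℕ) (f : ℕ → E),
      ∑ n ∈ Finset.range (2 ^ N), ‖matApply K (Finset.range (2 ^ N)) f n‖ ^ p * w n ≤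
        B * ∑ m ∈ Finset.range (2 ^ N), ‖f m‖ ^ p * w m) (S W : Finset ℕ) (f : ℕ → E) :
    ∑ n ∈ W, ‖matApply K S f n‖ ^ p * w n ≤ B * ∑ m ∈ S, ‖f m‖ ^ p * w m := by
  obtain ⟨N, hN⟩ := exists_subset_range_two_pow (S ∪ W)
  have h1 := h N (fun m => if m ∈ S then f m else 0)
  simp only [matApply_indicator K (Finset.union_subset_left hN)] at h1
  rw [sum_indicator_mul (Finset.union_subset_left hN) f (fun m v => ‖v‖ ^ p * w m)
    (by intro n; rw [norm_zero, Real.zero_rpow (by linarith), zero_mul])] at h1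
  exact (Finset.sum_le_sum_of_subset_of_nonneg (Finset.union_subset_right hN)
    fun n _ _ => mul_nonneg (Real.rpow_nonneg (norm_nonneg _) _) (hw n).le).trans h1

/-! ### From Muckenhoupt classes to uniform finite bounds. -/

theorem dualWeights_of_isMuckenhouptAp {p : ℝ} (hp : 1 < p) {w : ℕ → ℝ}
    (hw : IsMuckenhouptAp p w) :
    ∃ A, DualWeights p p.conjExponent w (fun n => w n ^ (-1 / (p - 1))) A := by
  obtain ⟨hpos, A, hA⟩ := hw
  have hp1 : 0 < p - 1 := by linarith
  have hconj := Real.HolderConjugate.conjExponent hp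
  set q := p.conjExponent with hq
  have hq' : q = p / (p - 1) := rfl
  have hp0 := hconj.pos
  set σ : ℕ → ℝ := fun n => w n ^ (-1 / (p - 1)) with hσ
  have hσpos : ∀ n, 0 < σ n := fun n => Real.rpow_pos_of_pos (hpos n) _
  set B := max A 1 with hB
  have hB0 : 0 < B := lt_max_of_lt_right one_pos
  refine ⟨B ^ (1 / p), hconj, hpos, hσpos, fun n => ?_, by positivity, fun a b => ?_⟩
  · rw [hσ]
    dsimp only
    rw [← Real.rpow_mul (hpos n).le, ← Real.rpow_add (hpos n)]
    have : 1 / p + -1 / (p - 1) * (1 / q) = 0 := by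
      rw [hq']
      field_simp
      ring
    rw [this, Real.rpow_zero]
  · rcases le_or_gt b a with hab | hab
    · rw [Finset.Ico_eq_empty (not_lt.2 hab)]
      simp only [Finset.sum_empty, Finset.card_empty, Nat.cast_zero, mul_zero]
      rw [Real.zero_rpow (by positivity), zero_mul]
    obtain ⟨m, rfl⟩ : ∃ m, b = m + 1 := ⟨b - 1, by omega⟩
    have ham : a ≤ m := by omega
    have h1 := (hA a m ham).trans (le_max_left A 1)
    have hI : Finset.Ico a (m + 1) = Finset.Icc a m := by
      ext x
      simp
    rw [hI, Nat.card_Icc]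
    have hc : ((m + 1 - a : ℕ) : ℝ) = (m : ℝ) - a + 1 := by
      rw [Nat.cast_sub (by omega)]
      push_cast
      ring
    rw [hc]
    have hL : (0 : ℝ) < (m : ℝ) - a + 1 := by
      have : (a : ℝ) ≤ m := by exact_mod_cast ham
      linarith
    set L := (m : ℝ) - a + 1
    have hw0 : 0 ≤ ∑ k ∈ Finset.Icc a m, w k := Finset.sum_nonneg fun n _ => (hpos n).le
    have hσ0 : 0 ≤ ∑ k ∈ Finset.Icc a m, σ k := Finset.sum_nonneg fun n _ => (hσpos n).le
    have h2 : (∑ k ∈ Finset.Icc a m, w k) * (∑ k ∈ Finset.Icc a m, σ k) ^ (p - 1) ≤ B * L ^ p := by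
      rw [mul_assoc, one_div_mul_eq_div, div_le_iff₀ (by positivity)] at h1
      exact h1
    have h3 := Real.rpow_le_rpow (by positivity) h2 (one_div_pos.2 hp0).le
    rw [Real.mul_rpow hw0 (by positivity), Real.mul_rpow hB0.le (by positivity),
      ← Real.rpow_mul hσ0, ← Real.rpow_mul hL.le, mul_one_div_cancel hp0.ne', Real.rpow_one] at h3
    have h4 : (p - 1) * (1 / p) = 1 / q := by
      rw [hq']
      field_simp
    rwa [h4] at h3

theorem a1Bound_of_isMuckenhouptA1 {w : ℕ → ℝ} (hw : IsMuckenhouptA1 w) : ∃ A, A1Bound w A := by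
  obtain ⟨hpos, A, hA⟩ := hw
  refine ⟨A, fun a b x hx => ?_⟩
  rw [Finset.mem_Ico] at hx
  obtain ⟨m, rfl⟩ : ∃ m, b = m + 1 := ⟨b - 1, by omega⟩
  have ham : a ≤ m := by omega
  have hI : Finset.Ico a (m + 1) = Finset.Icc a m := by
    ext x
    simp
  have hxI : x ∈ Finset.Icc a m := Finset.mem_Icc.2 (by omega)
  rw [hI, Nat.card_Icc]
  have hc : ((m + 1 - a : ℕ) : ℝ) = (m : ℝ) - a + 1 := by
    rw [Nat.cast_sub (by omega)]
    push_cast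
    ring
  rw [hc]
  have hL : (0 : ℝ) < (m : ℝ) - a + 1 := by
    have : (a : ℝ) ≤ m := by exact_mod_cast ham
    linarith
  have h1 := hA a m ham
  have h2 := Finset.le_sup' (fun k => 1 / w k) hxI
  have hw0 : 0 ≤ ∑ k ∈ Finset.Icc a m, w k := Finset.sum_nonneg fun n _ => (hpos n).le
  have hx0 := hpos x
  set L := (m : ℝ) - a + 1
  have h3 : 1 / L * (∑ k ∈ Finset.Icc a m, w k) * (1 / w x) ≤ A :=
    le_trans (by gcongr) h1
  have h4 : 1 / L * (∑ k ∈ Finset.Icc a m, w k) * (1 / w x) =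
      (∑ k ∈ Finset.Icc a m, w k) / (L * w x) := by field_simp
  rw [h4, div_le_iff₀ (by positivity)] at h3
  linarith

/-- An `A_1` weight is an `A_2` weight. -/
theorem A1Bound.dualWeights {w : ℕ → ℝ} (hw : ∀ n, 0 < w n) {A : ℝ} (hA : A1Bound w A) :
    DualWeights 2 2 w (fun n => (w n)⁻¹) (A ^ (1 / 2 : ℝ)) := by
  have hA1 := hA.one_le hw
  have hA0 : 0 < A := by linarith
  refine ⟨Real.HolderConjugate.two_two, hw, fun n => inv_pos.2 (hw n), fun n => ?_, by positivity,
    fun a b => ?_⟩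
  · rw [← Real.mul_rpow (hw n).le (inv_pos.2 (hw n)).le, mul_inv_cancel₀ (hw n).ne', Real.one_rpow]
  · have hw0 : 0 ≤ ∑ k ∈ Finset.Ico a b, w k := Finset.sum_nonneg fun n _ => (hw n).le
    have hσ0 : 0 ≤ ∑ k ∈ Finset.Ico a b, (w k)⁻¹ :=
      Finset.sum_nonneg fun n _ => (inv_pos.2 (hw n)).le
    have h1 : (∑ k ∈ Finset.Ico a b, w k) * ∑ k ∈ Finset.Ico a b, (w k)⁻¹ ≤
        A * ((Finset.Ico a b).card : ℝ) ^ 2 := by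
      rw [Finset.mul_sum]
      calc ∑ x ∈ Finset.Ico a b, (∑ k ∈ Finset.Ico a b, w k) * (w x)⁻¹
          ≤ ∑ x ∈ Finset.Ico a b, A * (Finset.Ico a b).card := by
            refine Finset.sum_le_sum fun x hx => ?_
            rw [← div_eq_mul_inv, div_le_iff₀ (hw x)]
            exact hA a b x hx
        _ = _ := by
            rw [Finset.sum_const, nsmul_eq_mul]
            ring
    rw [← Real.mul_rpow hw0 hσ0]
    have h2 := Real.rpow_le_rpow (by positivity) h1 (by norm_num : (0 : ℝ) ≤ 1 / 2)
    rwa [Real.mul_rpow hA0.le (by positivity), ← Real.sqrt_eq_rpow (_ ^ 2),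
      Real.sqrt_sq (by positivity)] at h2

theorem a1Bound_one : A1Bound (fun _ => 1) 1 := by
  intro a b x _
  simp

/-- Strong and weak type bounds for a matrix bounded on an unweighted `ℓ^q`. -/
theorem weighted_bounds {K : ℕ → ℕ → E →L[𝕜] F} (hK : IsLocalStandardKernel K) {q B : ℝ}
    (hq : 1 < q) (hB : 0 ≤ B)
    (hL : ∀ (S W : Finset ℕ) (f : ℕ → E),
      ∑ n ∈ W, ‖matApply K S f n‖ ^ q ≤ B * ∑ m ∈ S, ‖f m‖ ^ q) :
    (∀ p : ℝ, 1 < p → ∀ w : ℕ → ℝ, IsMuckenhouptAp p w → ∃ B' : ℝ, 0 ≤ B' ∧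
      ∀ (S W : Finset ℕ) (f : ℕ → E),
        ∑ n ∈ W, ‖matApply K S f n‖ ^ p * w n ≤ B' * ∑ m ∈ S, ‖f m‖ ^ p * w m) ∧
    (∀ w : ℕ → ℝ, IsMuckenhouptA1 w → ∃ B' : ℝ, 0 < B' ∧
      ∀ (S W : Finset ℕ) (f : ℕ → E) (t : ℝ), 0 < t →
        t * ∑ n ∈ W with t < ‖matApply K S f n‖, w n ≤ B' * ∑ m ∈ S, ‖f m‖ * w m) := by
  obtain ⟨C, hC, hosc⟩ := exists_hasOscBound hK
  -- The constant weight is in A_1, so the assumed ℓ^q bound yields the unweighted weak bound that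
  -- starts the sparse argument.
  obtain ⟨C₁, hC₁, hweak⟩ := weak_type hC hosc (w := fun _ => 1) (fun _ => one_pos) a1Bound_one hq hB
    (fun N f => by simpa using hL (Finset.range (2 ^ N)) (Finset.range (2 ^ N)) f)
  have hweak' : WeakBound K C₁ := fun S W f t ht => by simpa using hweak S W f t ht
  refine ⟨fun p hp w hw => ?_, fun w hw => ?_⟩
  · obtain ⟨A, hA⟩ := dualWeights_of_isMuckenhouptAp hp hw
    obtain ⟨B', hB', h⟩ := strong_type_window hC hosc hC₁ hweak' hA
    exact ⟨B', hB', strong_type hp hw.1 h⟩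
  · obtain ⟨A, hA⟩ := a1Bound_of_isMuckenhouptA1 hw
    -- The A_2 bound on ℓ^2(w) replaces the unweighted one as input to a second, weighted,
    -- Calderón-Zygmund decomposition.
    obtain ⟨B', hB', h⟩ := strong_type_window hC hosc hC₁ hweak' (hA.dualWeights hw.1)
    exact weak_type hC hosc hw.1 hA one_lt_two hB' h

/-! ### From finite sums to weighted sequence spaces -/

theorem lintegral_weightMeasure (w : ℕ → ℝ) (φ : ℕ → ℝ≥0∞) :
    ∫⁻ n, φ n ∂weightMeasure w = ∑' n, ENNReal.ofReal (w n) * φ n := by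
  rw [weightMeasure, lintegral_sum_measure]
  simp

theorem weightMeasure_apply (w : ℕ → ℝ) (s : Set ℕ) :
    weightMeasure w s = ∑' n, ENNReal.ofReal (w n) * s.indicator 1 n := by
  rw [weightMeasure, Measure.sum_apply _ (MeasurableSet.of_discrete)]
  simp

theorem eLpNorm_weightMeasure {p : ℝ} (hp : 0 < p) (w : ℕ → ℝ) (f : ℕ → E) :
    eLpNorm f (ENNReal.ofReal p) (weightMeasure w) =
      (∑' n, ENNReal.ofReal (‖f n‖ ^ p * w n)) ^ (1 / p) := by
  rw [eLpNorm_eq_lintegral_rpow_enorm_toReal (by simpa using hp) ENNReal.ofReal_ne_top,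
    ENNReal.toReal_ofReal hp.le, lintegral_weightMeasure]
  congr 2
  ext n
  rw [mul_comm, ENNReal.ofReal_mul (by positivity), ← ENNReal.ofReal_rpow_of_nonneg
    (norm_nonneg _) hp.le, ofReal_norm]

theorem memLp_weightMeasure_iff {p : ℝ} (hp : 0 < p) {w : ℕ → ℝ} (hw : ∀ n, 0 ≤ w n) {f : ℕ → E} :
    MemLp f (ENNReal.ofReal p) (weightMeasure w) ↔ Summable fun n => ‖f n‖ ^ p * w n := by
  have h0 : ∀ n, 0 ≤ ‖f n‖ ^ p * w n := fun n => mul_nonneg (by positivity) (hw n)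
  rw [MemLp, and_iff_right AEStronglyMeasurable.of_discrete, eLpNorm_weightMeasure hp,
    ENNReal.rpow_lt_top_iff_of_pos (by positivity)]
  constructor
  · intro h
    have := ENNReal.summable_toReal h.ne
    simpa only [ENNReal.toReal_ofReal (h0 _)] using this
  · intro h
    exact h.tsum_ofReal_lt_top

/-- Cauchy's criterion: small tails of `c` force small tails of `v`. It turns bounds on finite
matrix products into convergence of the infinite one. -/
theorem summable_of_modulus {c : ℕ → ℝ} (hc : Summable c) {v : ℕ → F} [CompleteSpace F]
    (h : ∀ ε > 0, ∃ η > 0, ∀ s : Finset ℕ, ∑ m ∈ s, c m < η → ‖∑ m ∈ s, v m‖ < ε) :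
    Summable v := by
  rw [summable_iff_vanishing_norm] at hc ⊢
  intro ε hε
  obtain ⟨η, hη, H⟩ := h ε hε
  obtain ⟨s, hs⟩ := hc η hη
  exact ⟨s, fun t ht => H t ((le_abs_self _).trans_lt (hs t ht))⟩

/-- The infinite matrix product. -/
noncomputable def matTsum (K : ℕ → ℕ → E →L[𝕜] F) (f : ℕ → E) (n : ℕ) : F := ∑' m, K n m (f m)

theorem tendsto_matApply {K : ℕ → ℕ → E →L[𝕜] F} {f : ℕ → E} {n : ℕ}
    (h : Summable fun m => K n m (f m)) :
    Filter.Tendsto (fun S => matApply K S f n) Filter.atTop (nhds (matTsum K f n)) :=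
  h.hasSum

section Strong

variable [CompleteSpace F] {K : ℕ → ℕ → E →L[𝕜] F} {p B : ℝ} {w : ℕ → ℝ}

theorem summable_of_strong (hp : 0 < p) (hw : ∀ n, 0 < w n) (hB : 0 ≤ B)
    (hS : ∀ (S W : Finset ℕ) (f : ℕ → E),
      ∑ n ∈ W, ‖matApply K S f n‖ ^ p * w n ≤ B * ∑ m ∈ S, ‖f m‖ ^ p * w m) {f : ℕ → E}
    (hf : Summable fun m => ‖f m‖ ^ p * w m) (n : ℕ) : Summable fun m => K n m (f m) := by
  -- The bound at the single row n is the modulus; B + 1 keeps the denominator positive when B = 0.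
  refine summable_of_modulus hf fun ε hε => ⟨ε ^ p * w n / (B + 1), ?_, fun s hs => ?_⟩
  · have := hw n
    positivity
  · have h1 := hS s {n} f
    rw [Finset.sum_singleton, matApply] at h1
    have h0 : 0 ≤ ∑ m ∈ s, ‖f m‖ ^ p * w m :=
      Finset.sum_nonneg fun m _ => mul_nonneg (by positivity) (hw m).le
    rw [lt_div_iff₀ (by positivity)] at hs
    have h2 : ‖∑ m ∈ s, K n m (f m)‖ ^ p * w n < ε ^ p * w n := by linarith
    have h3 := lt_of_mul_lt_mul_right h2 (hw n).le
    exact (Real.rpow_lt_rpow_iff (norm_nonneg _) hε.le hp).1 h3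

theorem sum_matTsum_le (hp : 0 < p) (hw : ∀ n, 0 < w n) (hB : 0 ≤ B)
    (hS : ∀ (S W : Finset ℕ) (f : ℕ → E),
      ∑ n ∈ W, ‖matApply K S f n‖ ^ p * w n ≤ B * ∑ m ∈ S, ‖f m‖ ^ p * w m) {f : ℕ → E}
    (hf : Summable fun m => ‖f m‖ ^ p * w m) (W : Finset ℕ) :
    ∑ n ∈ W, ‖matTsum K f n‖ ^ p * w n ≤ B * ∑' m, ‖f m‖ ^ p * w m := by
  have h0 : ∀ m, 0 ≤ ‖f m‖ ^ p * w m := fun m => mul_nonneg (by positivity) (hw m).le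
  refine le_of_tendsto (f := fun S => ∑ n ∈ W, ‖matApply K S f n‖ ^ p * w n) (x := Filter.atTop)
    (tendsto_finsetSum _ fun n _ => ?_) (Filter.Eventually.of_forall fun S => ?_)
  · exact (((tendsto_matApply (summable_of_strong hp hw hB hS hf n)).norm).rpow_const
      (Or.inr hp.le)).mul_const _
  · exact (hS S W f).trans (mul_le_mul_of_nonneg_left (hf.sum_le_tsum S fun m _ => h0 m) hB)

/-- The extension is the matrix product itself, so no density argument is needed and agreement with
the operator becomes an identity on ℓ^r. -/
theorem exists_strong_extension (hp : 0 < p) (hw : ∀ n, 0 < w n) (hB : 0 ≤ B)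
    (hS : ∀ (S W : Finset ℕ) (f : ℕ → E),
      ∑ n ∈ W, ‖matApply K S f n‖ ^ p * w n ≤ B * ∑ m ∈ S, ‖f m‖ ^ p * w m) :
    ∃ L : weightedLp 𝕜 E (ENNReal.ofReal p) w →ₗ[𝕜] weightedLp 𝕜 F (ENNReal.ofReal p) w,
      (∀ f, (L f : ℕ → F) = matTsum K f) ∧
      ∃ C : ℝ≥0, ∀ f : weightedLp 𝕜 E (ENNReal.ofReal p) w,
        eLpNorm (L f : ℕ → F) (ENNReal.ofReal p) (weightMeasure w) ≤
          C * eLpNorm (f : ℕ → E) (ENNReal.ofReal p) (weightMeasure w) := by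
  have hwn : ∀ n, 0 ≤ w n := fun n => (hw n).le
  have hsum : ∀ f : weightedLp 𝕜 E (ENNReal.ofReal p) w,
      Summable fun m => ‖(f : ℕ → E) m‖ ^ p * w m :=
    fun f => (memLp_weightMeasure_iff hp hwn).1 f.2
  have hmem : ∀ f : weightedLp 𝕜 E (ENNReal.ofReal p) w,
      matTsum K f ∈ weightedLp 𝕜 F (ENNReal.ofReal p) w := fun f =>
    (memLp_weightMeasure_iff hp hwn).2 (summable_of_sum_le
      (fun n => mul_nonneg (by positivity) (hwn n)) (sum_matTsum_le hp hw hB hS (hsum f)))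
  have hs : ∀ (f : weightedLp 𝕜 E (ENNReal.ofReal p) w) (n : ℕ),
      Summable fun m => K n m ((f : ℕ → E) m) :=
    fun f n => summable_of_strong hp hw hB hS (hsum f) n
  refine ⟨{ toFun := fun f => ⟨matTsum K f, hmem f⟩, map_add' := ?_, map_smul' := ?_ },
    fun f => rfl, Real.toNNReal B ^ (1 / p), fun f => ?_⟩
  · intro f g
    ext n
    simp only [matTsum, Submodule.coe_add, Pi.add_apply, map_add]
    exact (hs f n).tsum_add (hs g n)
  · intro c f
    ext n
    simp only [matTsum, Submodule.coe_smul, Pi.smul_apply, map_smul, RingHom.id_apply]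
    exact (hs f n).tsum_const_smul c
  · change eLpNorm (matTsum K f) _ _ ≤ _
    rw [eLpNorm_weightMeasure hp, eLpNorm_weightMeasure hp,
      ENNReal.coe_rpow_of_nonneg _ (by positivity),
      ← ENNReal.mul_rpow_of_nonneg _ _ (by positivity)]
    refine ENNReal.rpow_le_rpow ?_ (by positivity)
    rw [← ENNReal.ofReal_tsum_of_nonneg (fun m => mul_nonneg (by positivity) (hwn m)) (hsum f)]
    change _ ≤ ENNReal.ofReal B * _
    rw [← ENNReal.ofReal_mul hB]
    refine ENNReal.tsum_le_of_sum_range_le fun N => ?_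
    rw [← ENNReal.ofReal_sum_of_nonneg fun n _ => mul_nonneg (by positivity) (hwn n)]
    exact ENNReal.ofReal_le_ofReal (sum_matTsum_le hp hw hB hS (hsum f) _)

end Strong

section Weak

variable [CompleteSpace F] {K : ℕ → ℕ → E →L[𝕜] F} {B : ℝ} {w : ℕ → ℝ}

theorem summable_of_weak (hw : ∀ n, 0 < w n) (hB : 0 < B)
    (hS : ∀ (S W : Finset ℕ) (f : ℕ → E) (t : ℝ), 0 < t →
        t * ∑ n ∈ W with t < ‖matApply K S f n‖, w n ≤ B * ∑ m ∈ S, ‖f m‖ * w m) {f : ℕ → E}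
    (hf : Summable fun m => ‖f m‖ * w m) (n : ℕ) : Summable fun m => K n m (f m) := by
  refine summable_of_modulus hf fun ε hε => ⟨ε / 2 * w n / B, ?_, fun s hs => ?_⟩
  · have := hw n
    positivity
  · by_contra hc
    rw [not_lt] at hc
    -- Half of ε makes a partial sum of norm at least ε lie strictly above the level.
    have h1 := hS s {n} f (ε / 2) (by positivity)
    have h2 : ε / 2 < ‖matApply K s f n‖ := lt_of_lt_of_le (by linarith) hc
    rw [Finset.filter_singleton, if_pos h2, Finset.sum_singleton] at h1
    rw [lt_div_iff₀ hB] at hs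
    linarith

/-- Strict inequality at finitely many points is an open condition, so it already holds for some
finite truncation, whose weak bound applies. -/
theorem sum_matTsum_gt_le (hw : ∀ n, 0 < w n) (hB : 0 < B)
    (hS : ∀ (S W : Finset ℕ) (f : ℕ → E) (t : ℝ), 0 < t →
        t * ∑ n ∈ W with t < ‖matApply K S f n‖, w n ≤ B * ∑ m ∈ S, ‖f m‖ * w m) {f : ℕ → E}
    (hf : Summable fun m => ‖f m‖ * w m) (W : Finset ℕ) {t : ℝ} (ht : 0 < t) :
    t * ∑ n ∈ W with t < ‖matTsum K f n‖, w n ≤ B * ∑' m, ‖f m‖ * w m := by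
  set V := W.filter fun n => t < ‖matTsum K f n‖ with hV
  have hev : ∀ᶠ S in Filter.atTop, ∀ n ∈ V, t < ‖matApply K S f n‖ := by
    rw [Filter.eventually_all_finset]
    intro n hn
    exact (tendsto_matApply (summable_of_weak hw hB hS hf n)).norm.eventually_const_lt
      (Finset.mem_filter.1 hn).2
  obtain ⟨S, hSV⟩ := hev.exists
  have h1 := hS S V f t ht
  rw [Finset.filter_true_of_mem hSV] at h1
  exact h1.trans (mul_le_mul_of_nonneg_left (hf.sum_le_tsum S fun m _ =>
    mul_nonneg (norm_nonneg _) (hw m).le) hB.le)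

theorem exists_weak_extension (hw : ∀ n, 0 < w n) (hB : 0 < B)
    (hS : ∀ (S W : Finset ℕ) (f : ℕ → E) (t : ℝ), 0 < t →
        t * ∑ n ∈ W with t < ‖matApply K S f n‖, w n ≤ B * ∑ m ∈ S, ‖f m‖ * w m) :
    ∃ L : weightedLp 𝕜 E 1 w →ₗ[𝕜] weightedWeakL1 𝕜 F w,
      (∀ f, (L f : ℕ → F) = matTsum K f) ∧
      ∃ C : ℝ≥0, ∀ f : weightedLp 𝕜 E 1 w,
        weakL1Norm w (L f : ℕ → F) ≤ C * eLpNorm (f : ℕ → E) 1 (weightMeasure w) := by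
  have hwn : ∀ n, 0 ≤ w n := fun n => (hw n).le
  have hsum : ∀ f : weightedLp 𝕜 E 1 w, Summable fun m => ‖(f : ℕ → E) m‖ * w m := by
    intro f
    have h : MemLp (f : ℕ → E) (ENNReal.ofReal 1) (weightMeasure w) := by
      rw [ENNReal.ofReal_one]
      exact f.2
    rw [memLp_weightMeasure_iff one_pos hwn] at h
    simpa using h
  have hs : ∀ (f : weightedLp 𝕜 E 1 w) (n : ℕ), Summable fun m => K n m ((f : ℕ → E) m) :=
    fun f n => summable_of_weak hw hB hS (hsum f) n
  have hbound : ∀ f : weightedLp 𝕜 E 1 w, weakL1Norm w (matTsum K f) ≤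
      Real.toNNReal B * eLpNorm (f : ℕ → E) 1 (weightMeasure w) := by
    intro f
    have h1 := eLpNorm_weightMeasure one_pos w (f : ℕ → E)
    simp only [ENNReal.ofReal_one, Real.rpow_one, one_div_one, ENNReal.rpow_one] at h1
    rw [h1, ← ENNReal.ofReal_tsum_of_nonneg (fun m => mul_nonneg (norm_nonneg _) (hwn m)) (hsum f)]
    change _ ≤ ENNReal.ofReal B * _
    rw [← ENNReal.ofReal_mul hB.le]
    refine iSup_le fun t => ?_
    rcases eq_or_ne t 0 with rfl | ht0
    · simp
    have ht : (0 : ℝ) < t := by exact_mod_cast pos_iff_ne_zero.2 ht0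
    rw [weightMeasure_apply, ← ENNReal.tsum_mul_left]
    refine ENNReal.tsum_le_of_sum_range_le fun N => ?_
    have e : ∑ n ∈ Finset.range N, (t : ℝ≥0∞) * (ENNReal.ofReal (w n) *
        {n | t < ‖matTsum K f n‖₊}.indicator 1 n) =
        ENNReal.ofReal (t * ∑ n ∈ Finset.range N with (t : ℝ) < ‖matTsum K f n‖, w n) := by
      rw [← Finset.mul_sum, ENNReal.ofReal_mul ht.le, ENNReal.ofReal_coe_nnreal,
        ENNReal.ofReal_sum_of_nonneg fun n _ => hwn n, Finset.sum_filter]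
      congr 1
      refine Finset.sum_congr rfl fun n _ => ?_
      rw [Set.indicator_apply]
      by_cases h : t < ‖matTsum K f n‖₊
      · rw [if_pos (show n ∈ {n | t < ‖matTsum K f n‖₊} from h), if_pos (by exact_mod_cast h),
          Pi.one_apply, mul_one]
      · rw [if_neg (show n ∉ {n | t < ‖matTsum K f n‖₊} from h), if_neg (by exact_mod_cast h),
          mul_zero]
    rw [e]
    exact ENNReal.ofReal_le_ofReal (sum_matTsum_gt_le hw hB hS (hsum f) _ ht)
  refine ⟨{ toFun := fun f => ⟨matTsum K f, (hbound f).trans_lt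
      (ENNReal.mul_lt_top ENNReal.coe_lt_top f.2.2)⟩, map_add' := ?_, map_smul' := ?_ },
    fun f => rfl, Real.toNNReal B, hbound⟩
  · intro f g
    ext n
    simp only [matTsum, Submodule.coe_add, Pi.add_apply, map_add]
    exact (hs f n).tsum_add (hs g n)
  · intro c f
    ext n
    simp only [matTsum, Submodule.coe_smul, Pi.smul_apply, map_smul, RingHom.id_apply]
    exact (hs f n).tsum_const_smul c

end Weak

/-! ### The matrix of an operator on ℓ^r. -/

section Matrix

variable (r : ℝ≥0∞) [Fact (1 ≤ r)]
    (T : lp (fun _ : ℕ => E) r →L[𝕜] lp (fun _ : ℕ => F) r)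

/-- The matrix of an operator on sequences. -/
noncomputable def matrixOf (n m : ℕ) : E →L[𝕜] F :=
  (lp.evalCLM 𝕜 (fun _ : ℕ => F) r n).comp
    (T.comp (lp.singleContinuousLinearMap 𝕜 (fun _ : ℕ => E) r m))

theorem matrixOf_apply (n m : ℕ) (v : E) : matrixOf r T n m v = T (lp.single r m v) n := rfl

/-- For r < ∞ a sequence is the sum in ℓ^r of its one-point pieces, and coordinates of `T` are
continuous. -/
theorem matTsum_matrixOf (hr_top : r < ∞) (f : lp (fun _ : ℕ => E) r) :
    matTsum (matrixOf r T) f = T f := by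
  ext n
  exact (((lp.evalCLM 𝕜 (fun _ : ℕ => F) r n).comp T).hasSum
    (lp.hasSum_single hr_top.ne f)).tsum_eq

theorem matApply_matrixOf (S : Finset ℕ) (f : ℕ → E) (n : ℕ) :
    matApply (matrixOf r T) S f n = T (∑ m ∈ S, lp.single r m (f m)) n :=
  (map_sum ((lp.evalCLM 𝕜 (fun _ : ℕ => F) r n).comp T) (fun m => lp.single r m (f m)) S).symm

theorem sum_matApply_matrixOf_le (hr_top : r < ∞) (S W : Finset ℕ) (f : ℕ → E) :
    ∑ n ∈ W, ‖matApply (matrixOf r T) S f n‖ ^ r.toReal ≤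
      ‖T‖ ^ r.toReal * ∑ m ∈ S, ‖f m‖ ^ r.toReal := by
  have hr0 : 0 < r.toReal :=
    ENNReal.toReal_pos (zero_lt_one.trans_le Fact.out).ne' hr_top.ne
  simp only [matApply_matrixOf]
  have h := lp.norm_sum_single (E := fun _ : ℕ => E) hr0 f S
  rw [← h, ← Real.mul_rpow (norm_nonneg _) (norm_nonneg _)]
  refine (lp.sum_rpow_le_norm_rpow hr0 _ W).trans ?_
  exact Real.rpow_le_rpow (norm_nonneg _) (T.le_opNorm _) hr0.le

/-- A sequence supported at m vanishes at n ≠ m, so the kernel representation may be evaluated there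
and its sum has one term. -/
theorem matrixOf_eq {K : ℕ → ℕ → E →L[𝕜] F}
    (hTK : ∀ f : lp (fun _ : ℕ => E) r, (∃ k : ℕ, ∀ n > k, f n = 0) →
      ∀ n : ℕ, f n = 0 → T f n = ∑' m : ℕ, K n m (f m)) {n m : ℕ} (hnm : n ≠ m) :
    matrixOf r T n m = K n m := by
  ext v
  have h0 : ∀ k, k ≠ m → (lp.single r m v : lp (fun _ : ℕ => E) r) k = 0 :=
    fun k hk => lp.single_apply_ne (E := fun _ : ℕ => E) r m v hk
  rw [matrixOf_apply, hTK _ ⟨m, fun k hk => h0 k hk.ne'⟩ n (h0 n hnm), tsum_eq_single m]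
  · rw [lp.single_apply_self (E := fun _ : ℕ => E)]
  · intro k hk
    rw [h0 k hk, map_zero]

/-- The conditions see only off-diagonal values, since |n - m| > 2 |n - l| forces n ≠ m and l ≠ m.
The matrix of `T` is therefore a local standard kernel whatever its diagonal. -/
theorem isLocalStandardKernel_congr {K K' : ℕ → ℕ → E →L[𝕜] F} (hK : IsLocalStandardKernel K)
    (h : ∀ n m, n ≠ m → K' n m = K n m) : IsLocalStandardKernel K' := by
  obtain ⟨C, hC, h1, h2, h3⟩ := hK
  have hne : ∀ n m l : ℕ, |(n : ℝ) - m| > 2 * |(n : ℝ) - l| → n ≠ m ∧ l ≠ m := by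
    intro n m l hlt
    have h0 := abs_nonneg ((n : ℝ) - l)
    constructor
    · rintro rfl
      rw [sub_self, abs_zero] at hlt
      linarith
    · rintro rfl
      linarith
  refine ⟨C, hC, fun n m hnm => ?_, fun n m l hlt a b c d => ?_, fun n m l hlt a b c d => ?_⟩
  · rw [h n m hnm]
    exact h1 n m hnm
  · obtain ⟨hnm, hlm⟩ := hne n m l hlt
    rw [h n m hnm, h l m hlm]
    exact h2 n m l hlt a b c d
  · obtain ⟨hnm, hlm⟩ := hne n m l hlt
    rw [h m n hnm.symm, h m l hlm.symm]
    exact h3 n m l hlt a b c d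

end Matrix

end LocalCZ

theorem theorem2p1 {𝕜 B₁ B₂ : Type*} [RCLike 𝕜]
    [NormedAddCommGroup B₁] [NormedSpace 𝕜 B₁] [CompleteSpace B₁]
    [NormedAddCommGroup B₂] [NormedSpace 𝕜 B₂] [CompleteSpace B₂]
    (r : ℝ≥0∞) [Fact (1 ≤ r)] (hr : 1 < r) (hr_top : r < ∞)
    (T : lp (fun _ : ℕ => B₁) r →L[𝕜] lp (fun _ : ℕ => B₂) r)
    (K : ℕ → ℕ → B₁ →L[𝕜] B₂) (hK : IsLocalStandardKernel K)
    (hTK : ∀ f : lp (fun _ : ℕ => B₁) r, (∃ k : ℕ, ∀ n > k, f n = 0) →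
      ∀ n : ℕ, f n = 0 → T f n = ∑' m : ℕ, K n m (f m)) :
    (∀ p : ℝ, 1 < p → ∀ w : ℕ → ℝ, IsMuckenhouptAp p w →
      ∃ S : weightedLp 𝕜 B₁ (ENNReal.ofReal p) w →ₗ[𝕜] weightedLp 𝕜 B₂ (ENNReal.ofReal p) w,
        (∀ (f : lp (fun _ : ℕ => B₁) r)
          (hf : (f : ℕ → B₁) ∈ weightedLp 𝕜 B₁ (ENNReal.ofReal p) w),
          (S ⟨f, hf⟩ : ℕ → B₂) = T f) ∧
        ∃ C : ℝ≥0, ∀ f : weightedLp 𝕜 B₁ (ENNReal.ofReal p) w,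
          eLpNorm (S f : ℕ → B₂) (ENNReal.ofReal p) (weightMeasure w) ≤
            C * eLpNorm (f : ℕ → B₁) (ENNReal.ofReal p) (weightMeasure w)) ∧
    (∀ w : ℕ → ℝ, IsMuckenhouptA1 w →
      ∃ S : weightedLp 𝕜 B₁ 1 w →ₗ[𝕜] weightedWeakL1 𝕜 B₂ w,
        (∀ (f : lp (fun _ : ℕ => B₁) r) (hf : (f : ℕ → B₁) ∈ weightedLp 𝕜 B₁ 1 w),
          (S ⟨f, hf⟩ : ℕ → B₂) = T f) ∧
        ∃ C : ℝ≥0, ∀ f : weightedLp 𝕜 B₁ 1 w,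
          weakL1Norm w (S f : ℕ → B₂) ≤ C * eLpNorm (f : ℕ → B₁) 1 (weightMeasure w)) := by
  have hr1 : 1 < r.toReal := by
    rw [← ENNReal.toReal_one]
    exact (ENNReal.toReal_lt_toReal ENNReal.one_ne_top hr_top.ne).2 hr
  obtain ⟨hstrong, hweak⟩ := LocalCZ.weighted_bounds
    (LocalCZ.isLocalStandardKernel_congr hK fun n m hnm => LocalCZ.matrixOf_eq r T hTK hnm) hr1
    (Real.rpow_nonneg (norm_nonneg T) _) (LocalCZ.sum_matApply_matrixOf_le r T hr_top)
  refine ⟨fun p hp w hw => ?_, fun w hw => ?_⟩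
  · obtain ⟨B, hB, hS⟩ := hstrong p hp w hw
    obtain ⟨S, hST, hbound⟩ := LocalCZ.exists_strong_extension (by linarith) hw.1 hB hS
    exact ⟨S, fun f hf => (hST ⟨f, hf⟩).trans (LocalCZ.matTsum_matrixOf r T hr_top f), hbound⟩
  · obtain ⟨B, hB, hS⟩ := hweak w hw
    obtain ⟨S, hST, hbound⟩ := LocalCZ.exists_weak_extension hw.1 hB hS
    exact ⟨S, fun f hf => (hST ⟨f, hf⟩).trans (LocalCZ.matTsum_matrixOf r T hr_top f), hbound⟩
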